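/- Let $n\ge 1$, $p$, $K$ be integers and consider the latent model $X=AZ+W\in\mathbb R^p$ with label $Y\in\{0,1\}$, where (i) $W$ is independent of $(Z,Y)$; (ii) $\mathbb E[W]=0$; (iii) $A\in\mathbb R^{p\times K}$ is deterministic with rank $K$; (iv) $Z\mid Y=k\sim N_K(\alpha_k,\Sigma_{Z|Y})$ for $k\in\{0,1\}$, with $\alpha_0\ne\alpha_1$ and $\Sigma_{Z|Y}$ strictly positive definite; (v) $W=\Sigma_W^{1/2}\widetilde W$ with $\Sigma_W=\mathrm{Cov}(W)$, where $\mathbb E[\widetilde W]=0$, $\mathbb E[\widetilde W\widetilde W^\top]=I_p$ and $\widetilde W$ is $\gamma$-sub-Gaussian: $\mathbb E[\exp(t\,u^\top\widetilde W)]\le \exp(\gamma^2t^2/2)$ for all $t\in\mathbb R$ and all unit vectors $u$; (vi) $\pi_k=\mathbb P(Y=k)\ge c$ for $k\in\{0,1\}$, with $c\in(0,1/2]$. Let $(Z_i,W_i,Y_i)$, $1\le i\le n$, be i.i.d. copies of $(Z,W,Y)$, let $\mathbf X\in\mathbb R^{n\times p}$ have rows $X_i=AZ_i+W_i$, let $\Pi_n=I_n-n^{-1}\mathbf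 1_n\mathbf 1_n^\top$, and let $\sigma_1\ge\sigma_2\ge\cdots$ be the singular values of $\Pi_n\mathbf X$. For $c_0>0$ and $\nu>1$ define $$\widehat K\in\operatorname*{argmin}_{0\le k\le\bar K}\frac{\sum_{j>k}\sigma_j^2}{np-c_0(n+p)k},\qquad \bar K=\Big\lfloor \frac{\nu}{2c_0(1+\nu)}\,(n\wedge p)\Big\rfloor$$ (any minimizer may be chosen). Write $\lambda_j(\cdot)$ for the $j$-th largest eigenvalue and put $$\delta_W=\lambda_1(\Sigma_W)+\frac{\mathrm{tr}(\Sigma_W)}{n},\qquad \xi=\frac{\lambda_K(A\Sigma_{Z|Y}A^\top)}{\delta_W},\qquad r_e(\Sigma_W)=\frac{\mathrm{tr}(\Sigma_W)}{\lambda_1(\Sigma_W)}$$ where $\Sigma_W\neq 0$. **Theorem.** For all $\gamma>0$ and $C''>0$ there is a constant $c_*=c_*(\gamma,C'')>0$ such that for all $c_0\ge c_*$ and all $\nu>1$ there is a constant $C'=C'(\gamma,C'',c_0,\nu)>0$ such that for all $c\in(0,1/2]$ and $C>0$ there is a constant $M>0$, depending only on $\gamma,C'',c_0,\nu,c,C$,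 for which the following holds. For all $n,p,K$ and all models satisfying (i)–(vi) with $$K\le\bar K,\qquad \log p\le Cn,\qquad \xi\ge C',\qquad r_e(\Sigma_W)\ge C''(n\wedge p),$$ one has $$\mathbb P\{\widehat K=K\}\ \ge\ 1-\frac{M}{n}.$$ That is, $\mathbb P\{\widehat K=K\}=1-O(n^{-1})$, uniformly over all such models. -/

import Mathlib

open MeasureTheory ProbabilityTheory
open scoped NNReal

noncomputable section

/-- The `j`-th largest eigenvalue `λ_j(M)` (`1 ≤ j ≤ d`, counted with multiplicity) of a real
symmetric `d × d` matrix; zero outside this range. -/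
def eigDesc {d : ℕ} (M : Matrix (Fin d) (Fin d) ℝ) (j : ℕ) : ℝ :=
  open Classical in
  if h : M.IsHermitian ∧ 1 ≤ j ∧ j ≤ d then
    h.1.eigenvalues₀ ⟨j - 1, by rw [Fintype.card_fin]; omega⟩
  else 0

/-- The covariance matrix of a random vector. -/
def covMat {Ω : Type*} [MeasurableSpace Ω] (P : Measure Ω) {d : ℕ}
    (W : Ω → EuclideanSpace ℝ (Fin d)) : Matrix (Fin d) (Fin d) ℝ :=
  Matrix.of fun i j => covariance (fun ω => W ω i) (fun ω => W ω j) P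

/-- The sub-Gaussian noise condition: `W = Σ_W^{1/2} V` almost surely, where `Σ_W^{1/2}` (here `S`)
is the positive semidefinite square root of the covariance matrix of `W`, and `V` is a mean-zero
`γ`-sub-Gaussian random vector with `E[V Vᵀ] = I`. -/
def IsSubGaussianNoise {Ω : Type*} [MeasurableSpace Ω] (P : Measure Ω) {d : ℕ} (γ : ℝ≥0)
    (W : Ω → EuclideanSpace ℝ (Fin d)) : Prop :=
  ∃ (S : Matrix (Fin d) (Fin d) ℝ) (V : Ω → EuclideanSpace ℝ (Fin d)),
    S.PosSemidef ∧ S * S = covMat P W ∧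
    Measurable V ∧
    (∀ᵐ ω ∂P, W ω = Matrix.toEuclideanLin S (V ω)) ∧
    (Integrable V P ∧ ∫ ω, V ω ∂P = 0) ∧
    (∀ i j, ∫ ω, V ω i * V ω j ∂P = (1 : Matrix (Fin d) (Fin d) ℝ) i j) ∧
    (∀ u : EuclideanSpace ℝ (Fin d), ‖u‖ = 1 →
      HasSubgaussianMGF (fun ω => inner ℝ u (V ω)) (γ ^ 2) P)

/-- The law of `(Z, W, Y)` in the latent factor model `X = A Z + W`, `Y ∈ {0, 1}`:
`W` is independent of `(Z, Y)` and centred, `A` has rank `K`, `Z` is a two-component Gaussian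
mixture with labels `Y`, `W` is `γ`-sub-Gaussian noise, and the label probabilities
`π_0, π_1` are at least `c`. Here `α k` and `SZ` are the mean and covariance of `Z` given
`Y = k`. -/
structure LatentMixtureModel {Ω : Type*} [MeasurableSpace Ω] (P : Measure Ω) {p K : ℕ}
    (A : Matrix (Fin p) (Fin K) ℝ) (α : Fin 2 → EuclideanSpace ℝ (Fin K))
    (SZ : Matrix (Fin K) (Fin K) ℝ) (γ : ℝ≥0) (c : ℝ)
    (Z : Ω → EuclideanSpace ℝ (Fin K)) (W : Ω → EuclideanSpace ℝ (Fin p))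
    (Y : Ω → Fin 2) : Prop where
  measurable_Z : Measurable Z
  measurable_W : Measurable W
  measurable_Y : Measurable Y
  indep : IndepFun W (fun ω => (Z ω, Y ω)) P
  mean_W : Integrable W P ∧ ∫ ω, W ω ∂P = 0
  rank_A : A.rank = K
  posDef_SZ : SZ.PosDef
  means_ne : α 0 ≠ α 1
  gaussian : ∀ k, (cond P (Y ⁻¹' {k})).map Z = multivariateGaussian (α k) SZ
  noise : IsSubGaussianNoise P γ W
  prior : ∀ k, c ≤ P.real (Y ⁻¹' {k})

/-- `δ_W = λ_1(Σ_W) + tr(Σ_W) / n`. -/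
def noiseLevel {p : ℕ} (n : ℕ) (SW : Matrix (Fin p) (Fin p) ℝ) : ℝ :=
  eigDesc SW 1 + SW.trace / n

/-- The signal-to-noise ratio `ξ = λ_K(A Σ_{Z|Y} Aᵀ) / δ_W`. -/
def signalToNoise {p K : ℕ} (n : ℕ) (A : Matrix (Fin p) (Fin K) ℝ)
    (SZ : Matrix (Fin K) (Fin K) ℝ) (SW : Matrix (Fin p) (Fin p) ℝ) : ℝ :=
  eigDesc (A * SZ * A.transpose) K / noiseLevel n SW

/-- The effective rank `r_e(Σ_W) = tr(Σ_W) / λ_1(Σ_W)`. -/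
def effectiveRank {p : ℕ} (SW : Matrix (Fin p) (Fin p) ℝ) : ℝ :=
  SW.trace / eigDesc SW 1

/-- The centring projection `Π_n = I_n - n⁻¹ 1 1ᵀ`. -/
def centering (n : ℕ) : Matrix (Fin n) (Fin n) ℝ :=
  1 - (n : ℝ)⁻¹ • Matrix.of fun _ _ => (1 : ℝ)

/-- The data matrix, whose `i`-th row is `X_i = A Z_i + W_i`. -/
def dataMatrix {n p K : ℕ} (A : Matrix (Fin p) (Fin K) ℝ)
    (z : Fin n → EuclideanSpace ℝ (Fin K)) (w : Fin n → EuclideanSpace ℝ (Fin p)) :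
    Matrix (Fin n) (Fin p) ℝ :=
  Matrix.of fun i j => (Matrix.toEuclideanLin A (z i) + w i) j

/-- The criterion `(∑_{j > k} σ_j²) / (n p - c₀ (n + p) k)`, where `σ_1 ≥ σ_2 ≥ …` are the singular
values of `Π_n X`. Mathlib's `singularValues` are indexed from zero, so `σ_j` is entry `j - 1`. -/
def rankCriterion {n p : ℕ} (c₀ : ℝ) (X : Matrix (Fin n) (Fin p) ℝ) (k : ℕ) : ℝ :=
  (∑ j ∈ Finset.Icc (k + 1) (min n p),
      (Matrix.toEuclideanLin (centering n * X)).singularValues (j - 1) ^ 2) /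
    ((n : ℝ) * p - c₀ * ((n : ℝ) + p) * k)

/-- The largest candidate rank `⌊ν (n ∧ p) / (2 c₀ (1 + ν))⌋`. -/
def maxRank (c₀ ν : ℝ) (n p : ℕ) : ℕ :=
  ⌊ν / (2 * c₀ * (1 + ν)) * ((min n p : ℕ) : ℝ)⌋₊

/-- `k` is a minimiser of the criterion over `{0, …, maxRank}`. -/
def IsRankEstimate {n p : ℕ} (c₀ ν : ℝ) (X : Matrix (Fin n) (Fin p) ℝ) (k : ℕ) : Prop :=
  k ≤ maxRank c₀ ν n p ∧
    ∀ j ≤ maxRank c₀ ν n p, rankCriterion c₀ X k ≤ rankCriterion c₀ X j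

end

/-! The centred data matrix splits as `N + B`: `N` is the centred noise, and `B` is the centred
signal, which factors through `ℝ^K` and so has rank at most `K`. With `e = c₀(n+p)`, `D_k = np - ek`
and `S` the tail sum at `K`, squared singular values decrease and the denominators are affine in
`k`. Two first-order conditions therefore make `K` the strict minimiser: `σ_{K+1}² D_K < e S < σ_K²
D_K` (`tail_ratio_lt`).

Weyl's inequality for low-rank perturbations reduces both conditions to the noise. It gives
`σ_{K+1}(N+B) ≤ σ_1(N)`, and it places `S` between `‖N‖_F² - 2K‖N‖²` and `‖N‖_F²`
(`IsRankEstimate.eq_of_signal_noise`). With high probability `‖N‖² ≲ n λ_1 + tr`, while `‖N‖_F² ≍ n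
tr`. The effective-rank condition spreads the noise over enough directions for a large `c₀` to give
the left inequality. The right inequality follows from `σ_K² ≳ n λ_K(A Σ_{Z|Y} Aᵀ)` and a large
signal-to-noise ratio (`IsRankEstimate.eq_of_bounds`).

Three probabilistic estimates remain. The noise operator norm is controlled by a net in `ℝ^n` and
Gaussian linearisation of `exp(s‖ξ‖²)`, so the dimension `p` enters only through the trace
(`measure_exists_sum_sq_inner_gt_le`). The Frobenius norm is controlled by Chebyshev's inequality,
which is the source of the rate `1/n` (`measure_norm_sq_sum_bounds_le`). The signal Gram matrix is
bounded below through differences over disjoint pairs of observations. Equal labels cancel the class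
mean and occur with probability at least `1/2`, and whitening makes the design standard Gaussian and
independent of the labels (`measure_exists_pairEnergy_lt_le`, `map_whiten_prodMk_label`). A large
`c₀` also forces `1000 K ≤ n`, so a net in `ℝ^K` is affordable. -/

/-! ### Variational bounds for singular values -/

section SingularValueInequalities

open Module

variable {E F : Type*} [NormedAddCommGroup E] [InnerProductSpace ℝ E] [FiniteDimensional ℝ E]
  [NormedAddCommGroup F] [InnerProductSpace ℝ F] [FiniteDimensional ℝ F]

/-- The right singular vectors of `T`, in decreasing order of the singular values. -/
noncomputable def rightSingularBasis (T : E →ₗ[ℝ] F) :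
    OrthonormalBasis (Fin (finrank ℝ E)) ℝ E :=
  T.isSymmetric_adjoint_comp_self.eigenvectorBasis rfl

theorem norm_sq_apply_eq_sum_singularValues (T : E →ₗ[ℝ] F) (x : E) :
    ‖T x‖ ^ 2 = ∑ j : Fin (finrank ℝ E),
      T.singularValues j ^ 2 * inner ℝ (rightSingularBasis T j) x ^ 2 := by
  set b := rightSingularBasis T with hb
  have h1 : ‖T x‖ ^ 2 = inner ℝ x ((T.adjoint ∘ₗ T) x) := by
    rw [LinearMap.comp_apply, LinearMap.adjoint_inner_right, real_inner_self_eq_norm_sq]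
  rw [h1, ← b.sum_inner_mul_inner]
  refine Finset.sum_congr rfl fun j _ => ?_
  have h2 : inner ℝ (b j) ((T.adjoint ∘ₗ T) x) =
      T.singularValues j ^ 2 * inner ℝ (b j) x := by
    rw [← T.isSymmetric_adjoint_comp_self, hb, rightSingularBasis,
      T.isSymmetric_adjoint_comp_self.apply_eigenvectorBasis rfl,
      T.sq_singularValues_fin rfl j, inner_smul_left]
    simp
  rw [h2, real_inner_comm]
  ring

theorem norm_sq_apply_le_of_inner_eq_zero (T : E →ₗ[ℝ] F) (k : ℕ) (x : E)
    (hx : ∀ j : Fin (finrank ℝ E), (j : ℕ) < k → inner ℝ (rightSingularBasis T j) x = 0) :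
    ‖T x‖ ^ 2 ≤ T.singularValues k ^ 2 * ‖x‖ ^ 2 := by
  rw [norm_sq_apply_eq_sum_singularValues, ← (rightSingularBasis T).sum_sq_inner_right x,
    Finset.mul_sum]
  refine Finset.sum_le_sum fun j _ => ?_
  rcases lt_or_ge (j : ℕ) k with h | h
  · simp [hx j h]
  · gcongr
    · exact T.singularValues_nonneg _
    · exact T.singularValues_antitone h

theorem le_norm_sq_apply_of_inner_eq_zero (T : E →ₗ[ℝ] F) (k : ℕ) (x : E)
    (hx : ∀ j : Fin (finrank ℝ E), k < (j : ℕ) → inner ℝ (rightSingularBasis T j) x = 0) :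
    T.singularValues k ^ 2 * ‖x‖ ^ 2 ≤ ‖T x‖ ^ 2 := by
  rw [norm_sq_apply_eq_sum_singularValues, ← (rightSingularBasis T).sum_sq_inner_right x,
    Finset.mul_sum]
  refine Finset.sum_le_sum fun j _ => ?_
  rcases lt_or_ge k (j : ℕ) with h | h
  · simp [hx j h]
  · gcongr
    · exact T.singularValues_nonneg _
    · exact T.singularValues_antitone h

/-- The coordinates along the right singular vectors selected by a predicate. -/
noncomputable def singularCoords (T : E →ₗ[ℝ] F) (q : Fin (finrank ℝ E) → Prop) :
    E →ₗ[ℝ] ({j // q j} → ℝ) :=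
  LinearMap.pi fun j => innerₛₗ ℝ (rightSingularBasis T j)

/-- **Weyl's inequality** for a perturbation of rank at most `k`. -/
theorem singularValues_add_le_of_finrank_range_le (N B : E →ₗ[ℝ] F) (k i : ℕ)
    (hB : finrank ℝ (LinearMap.range B) ≤ k) :
    (N + B).singularValues (i + k) ≤ N.singularValues i := by
  rcases le_or_gt (finrank ℝ E) (i + k) with hd | hd
  · rw [LinearMap.singularValues_of_finrank_le _ hd]
    exact N.singularValues_nonneg _
  classical
  -- At most `i + k + (d - i - k - 1) < d` linear constraints, so some nonzero `x` satisfies all of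
  -- them. There `N` and `N + B` agree, `‖N x‖` is at most `σ_i(N)‖x‖`, and `‖(N + B) x‖` is at
  -- least `σ_{i+k}(N + B)‖x‖`.
  let L := (singularCoords N fun j => (j : ℕ) < i).prod
    (B.rangeRestrict.prod (singularCoords (N + B) fun j => i + k < (j : ℕ)))
  have hlt : finrank ℝ (({j : Fin (finrank ℝ E) // (j : ℕ) < i} → ℝ) × LinearMap.range B ×
      ({j : Fin (finrank ℝ E) // i + k < (j : ℕ)} → ℝ)) < finrank ℝ E := by
    rw [finrank_prod, finrank_prod, finrank_fintype_fun_eq_card, finrank_fintype_fun_eq_card]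
    have h1 : Fintype.card {j : Fin (finrank ℝ E) // (j : ℕ) < i} ≤ i := by
      simpa using Fintype.card_le_of_injective
        (fun j : {j : Fin (finrank ℝ E) // (j : ℕ) < i} => (⟨j.1, j.2⟩ : Fin i))
        (fun a b h => by simpa [Subtype.ext_iff, Fin.ext_iff] using h)
    have h2 : Fintype.card {j : Fin (finrank ℝ E) // i + k < (j : ℕ)} ≤
        finrank ℝ E - (i + k + 1) := by
      simpa using Fintype.card_le_of_injective
        (fun j : {j : Fin (finrank ℝ E) // i + k < (j : ℕ)} =>
          (⟨j.1 - (i + k + 1), by have := j.2; have := j.1.2; omega⟩ :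
            Fin (finrank ℝ E - (i + k + 1))))
        (fun a b h => by
          have h' : (a.1 : ℕ) - (i + k + 1) = b.1 - (i + k + 1) := by
            simpa using congrArg Fin.val h
          have := a.2; have := b.2
          ext; omega)
    omega
  obtain ⟨x, hx, hx0⟩ := Submodule.exists_mem_ne_zero_of_ne_bot
    (LinearMap.ker_ne_bot_of_finrank_lt (f := L) hlt)
  have hL : L x = 0 := hx
  have ha : singularCoords N (fun j => (j : ℕ) < i) x = 0 := congrArg Prod.fst hL
  have hb : B.rangeRestrict x = 0 := congrArg (fun z => z.2.1) hL
  have hc : singularCoords (N + B) (fun j => i + k < (j : ℕ)) x = 0 :=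
    congrArg (fun z => z.2.2) hL
  have hBx : B x = 0 := by simpa using congrArg Subtype.val hb
  have h1 := norm_sq_apply_le_of_inner_eq_zero N i x fun j hj => congrFun ha ⟨j, hj⟩
  have h2 := le_norm_sq_apply_of_inner_eq_zero (N + B) (i + k) x fun j hj => congrFun hc ⟨j, hj⟩
  have h3 : (N + B) x = N x := by simp [hBx]
  rw [h3] at h2
  have hpos : 0 < ‖x‖ ^ 2 := by positivity
  exact le_of_sq_le_sq (le_of_mul_le_mul_right (h2.trans h1) hpos) (N.singularValues_nonneg _)

/-- If `T` expands all vectors of a subspace of dimension greater than `k`, its `k`-th singular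
value is bounded below. -/
theorem le_sq_singularValues_of_forall_mem (T : E →ₗ[ℝ] F) (k : ℕ) (U : Submodule ℝ E)
    (hU : k < finrank ℝ U) (a : ℝ) (h : ∀ x ∈ U, a * ‖x‖ ^ 2 ≤ ‖T x‖ ^ 2) :
    a ≤ T.singularValues k ^ 2 := by
  classical
  let L := (singularCoords T fun j => (j : ℕ) < k) ∘ₗ U.subtype
  have hlt : finrank ℝ ({j : Fin (finrank ℝ E) // (j : ℕ) < k} → ℝ) < finrank ℝ U := by
    rw [finrank_fintype_fun_eq_card]
    refine lt_of_le_of_lt ?_ hU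
    simpa using Fintype.card_le_of_injective
      (fun j : {j : Fin (finrank ℝ E) // (j : ℕ) < k} => (⟨j.1, j.2⟩ : Fin k))
      (fun a b h => by simpa [Subtype.ext_iff, Fin.ext_iff] using h)
  obtain ⟨x, hx, hx0⟩ := Submodule.exists_mem_ne_zero_of_ne_bot
    (LinearMap.ker_ne_bot_of_finrank_lt (f := L) hlt)
  have hL : L x = 0 := hx
  have h1 := norm_sq_apply_le_of_inner_eq_zero T k x fun j hj => congrFun hL ⟨j, hj⟩
  have hx0' : (x : E) ≠ 0 := by simpa using hx0
  have hpos : 0 < ‖(x : E)‖ ^ 2 := by positivity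
  exact le_of_mul_le_mul_right ((h x x.2).trans h1) hpos

theorem sq_singularValues_le_of_forall (T : E →ₗ[ℝ] F) (k : ℕ) {a : ℝ} (ha : 0 ≤ a)
    (h : ∀ x, ‖T x‖ ^ 2 ≤ a * ‖x‖ ^ 2) : T.singularValues k ^ 2 ≤ a := by
  rcases le_or_gt (finrank ℝ E) k with hk | hk
  · rw [T.singularValues_of_finrank_le hk]; simpa using ha
  have h1 := le_norm_sq_apply_of_inner_eq_zero T k (rightSingularBasis T ⟨k, hk⟩) fun j hj => by
    have : j ≠ ⟨k, hk⟩ := fun h => by simp [h] at hj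
    exact (rightSingularBasis T).orthonormal.2 this
  have h2 := h1.trans (h _)
  simpa [(rightSingularBasis T).orthonormal.1] using h2

theorem sum_sq_singularValues_eq_sum_norm_sq {ι : Type*} [Fintype ι] (T : E →ₗ[ℝ] F)
    (b : OrthonormalBasis ι ℝ E) :
    ∑ j ∈ Finset.range (finrank ℝ E), T.singularValues j ^ 2 = ∑ i, ‖T (b i)‖ ^ 2 := by
  simp_rw [norm_sq_apply_eq_sum_singularValues T]
  rw [Finset.sum_comm, Finset.sum_range]
  refine Finset.sum_congr rfl fun j _ => ?_
  rw [← Finset.mul_sum, b.sum_sq_inner_left]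
  simp [(rightSingularBasis T).orthonormal.1]

end SingularValueInequalities

/-! ### Deterministic analysis of the rank criterion -/

section RankSelection

open Module

variable {E F : Type*} [NormedAddCommGroup E] [InnerProductSpace ℝ E] [FiniteDimensional ℝ E]
  [NormedAddCommGroup F] [InnerProductSpace ℝ F] [FiniteDimensional ℝ F]

/-- Weyl's inequality shifts indices by `k`: the tail of `N + B` from `k` on is dominated term by
term by the sequence of `N` from `0` on. -/
theorem sum_tail_sq_singularValues_add_le (N B : E →ₗ[ℝ] F) (k : ℕ)
    (hB : finrank ℝ (LinearMap.range B) ≤ k) :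
    ∑ j ∈ Finset.Ico k (finrank ℝ E), (N + B).singularValues j ^ 2 ≤
      ∑ j ∈ Finset.range (finrank ℝ E), N.singularValues j ^ 2 := by
  rw [Finset.sum_Ico_eq_sum_range]
  calc _ ≤ ∑ i ∈ Finset.range (finrank ℝ E - k), N.singularValues i ^ 2 := by
        refine Finset.sum_le_sum fun i _ => ?_
        rw [add_comm k i]
        gcongr
        · exact (N + B).singularValues_nonneg _
        · exact singularValues_add_le_of_finrank_range_le N B k i hB
    _ ≤ _ := Finset.sum_le_sum_of_subset_of_nonneg
        (Finset.range_subset_range.2 (Nat.sub_le _ _)) fun _ _ _ => sq_nonneg _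

/-- Weyl's inequality for `N = (N + B) + (-B)` bounds the tail below by the squared singular values
of `N` from index `2k` on. The `2k` missing terms cost at most `s` each. -/
theorem le_sum_tail_sq_singularValues_add (N B : E →ₗ[ℝ] F) (k : ℕ)
    (hB : finrank ℝ (LinearMap.range B) ≤ k) (hk : k ≤ finrank ℝ E) {s : ℝ}
    (hs : ∀ j, N.singularValues j ^ 2 ≤ s) :
    ∑ j ∈ Finset.range (finrank ℝ E), N.singularValues j ^ 2 - 2 * k * s ≤
      ∑ j ∈ Finset.Ico k (finrank ℝ E), (N + B).singularValues j ^ 2 := by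
  set d := finrank ℝ E
  have hB' : finrank ℝ (LinearMap.range (-B)) ≤ k := by rwa [LinearMap.range_neg]
  have h1 : ∑ j ∈ Finset.Ico k d, N.singularValues (j + k) ^ 2 ≤
      ∑ j ∈ Finset.Ico k d, (N + B).singularValues j ^ 2 := by
    refine Finset.sum_le_sum fun j _ => ?_
    have := singularValues_add_le_of_finrank_range_le (N + B) (-B) k j hB'
    rw [add_neg_cancel_right] at this
    gcongr
    exact N.singularValues_nonneg _
  have h2 : ∑ j ∈ Finset.Ico k d, N.singularValues (j + k) ^ 2 =
      ∑ j ∈ Finset.Ico (k + k) (d + k), N.singularValues j ^ 2 :=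
    Finset.sum_Ico_add' (fun j => N.singularValues j ^ 2) k d k
  have h3 : ∑ j ∈ Finset.range d, N.singularValues j ^ 2 ≤
      ∑ j ∈ Finset.range (d + k), N.singularValues j ^ 2 :=
    Finset.sum_le_sum_of_subset_of_nonneg
      (Finset.range_subset_range.2 (Nat.le_add_right _ _)) fun _ _ _ => sq_nonneg _
  have h4 := Finset.sum_range_add_sum_Ico (fun j => N.singularValues j ^ 2)
    (show k + k ≤ d + k by omega)
  have h5 : ∑ j ∈ Finset.range (k + k), N.singularValues j ^ 2 ≤ 2 * k * s := by
    calc _ ≤ ∑ _j ∈ Finset.range (k + k), s := Finset.sum_le_sum fun j _ => hs j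
      _ = 2 * k * s := by
          rw [Finset.sum_const, Finset.card_range, nsmul_eq_mul]; push_cast; ring
  linarith

/-- A penalised tail-sum ratio is uniquely minimised at `K` as soon as the increments satisfy
the two first-order conditions at `K`. -/
theorem tail_ratio_lt {a : ℕ → ℝ} (ha : Antitone a) {m Kb K : ℕ} {N₀ e : ℝ}
    (hm : Kb ≤ m) (hD : ∀ k : ℕ, k ≤ Kb → 0 < N₀ - e * k) (hK1 : 1 ≤ K) (hK : K ≤ Kb)
    (hlow : e * ∑ j ∈ Finset.Ico K m, a j < a (K - 1) * (N₀ - e * K))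
    (hup : a K * (N₀ - e * K) < e * ∑ j ∈ Finset.Ico K m, a j)
    {k : ℕ} (hk : k ≤ Kb) (hne : k ≠ K) :
    (∑ j ∈ Finset.Ico K m, a j) / (N₀ - e * K) < (∑ j ∈ Finset.Ico k m, a j) / (N₀ - e * k) := by
  have hDK := hD K hK
  -- Let `S` be the tail at `K` and `Δ` the sum of the terms between `k` and `K`. After cancellation
  -- the claim is `e(K-k)S < Δ(N₀-eK)` when `k < K`, and the reverse comparison `Δ(N₀-eK) < e(k-K)S`
  -- when `k > K`. Monotonicity compares `Δ` with `|K-k|` copies of `a (K-1)` or `a K`.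
  rw [div_lt_div_iff₀ hDK (hD k hk)]
  rcases lt_or_gt_of_ne hne with h | h
  · have hsplit := Finset.sum_Ico_consecutive a h.le (hK.trans hm)
    have hge : ((K : ℝ) - k) * a (K - 1) ≤ ∑ j ∈ Finset.Ico k K, a j := by
      calc _ = ∑ _j ∈ Finset.Ico k K, a (K - 1) := by simp [Nat.cast_sub h.le]
        _ ≤ _ := Finset.sum_le_sum fun j hj => ha (by have := Finset.mem_Ico.1 hj; omega)
    have hpos : (0 : ℝ) < (K : ℝ) - k := by
      have : (k : ℝ) < K := by exact_mod_cast h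
      linarith
    rw [← hsplit]
    have h1 := mul_le_mul_of_nonneg_right hge hDK.le
    have h2 := mul_lt_mul_of_pos_left hlow hpos
    nlinarith
  · have hsplit := Finset.sum_Ico_consecutive a h.le (hk.trans hm)
    have hle : ∑ j ∈ Finset.Ico K k, a j ≤ ((k : ℝ) - K) * a K := by
      calc _ ≤ ∑ _j ∈ Finset.Ico K k, a K :=
            Finset.sum_le_sum fun j hj => ha (Finset.mem_Ico.1 hj).1
        _ = _ := by simp [Nat.cast_sub h.le]
    have hpos : (0 : ℝ) < (k : ℝ) - K := by
      have : (K : ℝ) < k := by exact_mod_cast h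
      linarith
    rw [← hsplit] at hup ⊢
    have h1 := mul_le_mul_of_nonneg_right hle hDK.le
    have h2 := mul_lt_mul_of_pos_left hup hpos
    nlinarith

/-- Zero-based indices, with the tail run up to `p`: singular values from index `n` on vanish
because the range lies in `ℝ^n`. -/
theorem rankCriterion_eq {n p : ℕ} (c₀ : ℝ) (X : Matrix (Fin n) (Fin p) ℝ) (k : ℕ) :
    rankCriterion c₀ X k =
      (∑ j ∈ Finset.Ico k p,
        (Matrix.toEuclideanLin (centering n * X)).singularValues j ^ 2) /
      ((n : ℝ) * p - c₀ * ((n : ℝ) + p) * k) := by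
  unfold rankCriterion
  congr 1
  set T := Matrix.toEuclideanLin (centering n * X)
  have h1 : ∑ j ∈ Finset.Icc (k + 1) (min n p), T.singularValues (j - 1) ^ 2 =
      ∑ j ∈ Finset.Ico k (min n p), T.singularValues j ^ 2 := by
    have h := Finset.sum_Ico_add' (fun j => T.singularValues (j - 1) ^ 2) k (min n p) 1
    simp only [Nat.add_sub_cancel] at h
    rw [h]
    rfl
  rw [h1]
  refine Finset.sum_subset (Finset.Ico_subset_Ico_right (min_le_right _ _)) fun j hj hj' => ?_
  have hn : n ≤ j := by
    simp only [Finset.mem_Ico] at hj hj'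
    omega
  have : T.singularValues j = 0 := by
    rw [LinearMap.singularValues_eq_zero_iff_le_finrank_range]
    refine le_trans (Submodule.finrank_le _) ?_
    simpa using hn
  simp [this]

theorem le_maxRank_iff {c₀ ν : ℝ} (hc₀ : 0 < c₀) (hν : 0 < ν) {n p k : ℕ} :
    k ≤ maxRank c₀ ν n p ↔ (k : ℝ) ≤ ν / (2 * c₀ * (1 + ν)) * ((min n p : ℕ) : ℝ) :=
  Nat.le_floor_iff (by positivity)

/-- Since `(n+p)(n∧p) ≤ 2np`, the cap on `k` lets the penalty consume at most the fraction `ν/(1+ν)`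
of `np`. Every admissible denominator is then at least `np/(1+ν)`. -/
theorem penalty_mul_le {c₀ ν : ℝ} (hc₀ : 0 < c₀) (hν : 0 < ν) {n p k : ℕ}
    (hk : k ≤ maxRank c₀ ν n p) :
    c₀ * ((n : ℝ) + p) * k ≤ ν / (1 + ν) * ((n : ℝ) * p) := by
  have h := (le_maxRank_iff hc₀ hν).1 hk
  have hmin : ((n : ℝ) + p) * ((min n p : ℕ) : ℝ) ≤ 2 * ((n : ℝ) * p) := by
    rcases le_total n p with h | h
    · rw [min_eq_left h]
      have : (n : ℝ) ≤ p := by exact_mod_cast h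
      nlinarith [Nat.cast_nonneg (α := ℝ) n]
    · rw [min_eq_right h]
      have : (p : ℝ) ≤ n := by exact_mod_cast h
      nlinarith [Nat.cast_nonneg (α := ℝ) p]
  calc c₀ * ((n : ℝ) + p) * k
      ≤ c₀ * ((n : ℝ) + p) * (ν / (2 * c₀ * (1 + ν)) * ((min n p : ℕ) : ℝ)) := by gcongr
    _ = ν / (2 * (1 + ν)) * (((n : ℝ) + p) * ((min n p : ℕ) : ℝ)) := by field_simp
    _ ≤ ν / (2 * (1 + ν)) * (2 * ((n : ℝ) * p)) := by gcongr
    _ = ν / (1 + ν) * ((n : ℝ) * p) := by field_simp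

/-- The rank estimate is exact for a low-rank signal `B` plus noise `N` when the noise is
spread out and the signal is strong. -/
theorem IsRankEstimate.eq_of_signal_noise {n p K : ℕ} {c₀ ν : ℝ} (hc₀ : 1 ≤ c₀) (hν : 0 < ν)
    {X : Matrix (Fin n) (Fin p) ℝ} (hn : 0 < n) (hp : 0 < p) (hK1 : 1 ≤ K)
    (hK : K ≤ maxRank c₀ ν n p)
    (N B : EuclideanSpace ℝ (Fin p) →ₗ[ℝ] EuclideanSpace ℝ (Fin n))
    (hX : Matrix.toEuclideanLin (centering n * X) = N + B)
    (hB : finrank ℝ (LinearMap.range B) ≤ K) {s g : ℝ} (hs : 0 ≤ s)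
    (hN : ∀ x, ‖N x‖ ^ 2 ≤ s * ‖x‖ ^ 2)
    (U : Submodule ℝ (EuclideanSpace ℝ (Fin p))) (hU : K ≤ finrank ℝ U)
    (hg : ∀ x ∈ U, g * ‖x‖ ^ 2 ≤ ‖B x‖ ^ 2)
    (hnoise : 2 * ((n : ℝ) * p) * s <
      c₀ * ((n : ℝ) + p) * ∑ j ∈ Finset.range p, N.singularValues j ^ 2)
    (hsignal : (1 + ν) * (c₀ * ((n : ℝ) + p) * ∑ j ∈ Finset.range p, N.singularValues j ^ 2) <
      n * p * (g / 2 - s))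
    {k : ℕ} (hk : IsRankEstimate c₀ ν X k) : k = K := by
  have hc₀' : 0 < c₀ := by linarith
  have hnp : (0 : ℝ) < (n : ℝ) * p := by positivity
  have hpen : ∀ j : ℕ, j ≤ maxRank c₀ ν n p →
      c₀ * ((n : ℝ) + p) * j ≤ ν / (1 + ν) * ((n : ℝ) * p) := fun j hj =>
    penalty_mul_le hc₀' hν hj
  have hν1 : ν / (1 + ν) = 1 - 1 / (1 + ν) := by field_simp; ring
  have hD : ∀ j : ℕ, j ≤ maxRank c₀ ν n p →
      (n : ℝ) * p / (1 + ν) ≤ n * p - c₀ * ((n : ℝ) + p) * j := fun j hj => by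
    have := hpen j hj
    rw [hν1] at this
    have e : (1 - 1 / (1 + ν)) * ((n : ℝ) * p) = n * p - n * p / (1 + ν) := by ring
    linarith
  have hq : 0 < (n : ℝ) * p / (1 + ν) := by positivity
  have hmax : maxRank c₀ ν n p ≤ p := by
    have h := (le_maxRank_iff hc₀' hν).1 (le_refl (maxRank c₀ ν n p))
    have h1 : ν / (2 * c₀ * (1 + ν)) ≤ 1 := by
      rw [div_le_one (by positivity)]; nlinarith
    have h2 : ((min n p : ℕ) : ℝ) ≤ p := by exact_mod_cast min_le_right n p
    have h3 : ((min n p : ℕ) : ℝ) ≥ 0 := by positivity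
    have : (maxRank c₀ ν n p : ℝ) ≤ p := by nlinarith
    exact_mod_cast this
  by_contra hne
  have hfin : finrank ℝ (EuclideanSpace ℝ (Fin p)) = p := by simp
  have hsv : ∀ j, N.singularValues j ^ 2 ≤ s := fun j =>
    sq_singularValues_le_of_forall N j hs hN
  have hup := sum_tail_sq_singularValues_add_le N B K hB
  have hlo := le_sum_tail_sq_singularValues_add N B K hB (by rw [hfin]; exact hK.trans hmax) hsv
  rw [hfin] at hup hlo
  set T := N + B with hT
  set S := ∑ j ∈ Finset.Ico K p, T.singularValues j ^ 2 with hS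
  set Fr := ∑ j ∈ Finset.range p, N.singularValues j ^ 2 with hFr
  have hDK := hD K hK
  have hlow : c₀ * ((n : ℝ) + p) * S <
      T.singularValues (K - 1) ^ 2 * (n * p - c₀ * ((n : ℝ) + p) * K) := by
    -- On `U`, `‖B x‖² ≤ 2‖T x‖² + 2‖N x‖²`. The zero-based index `K - 1` is the `K`-th singular
    -- value.
    have h1 : g / 2 - s ≤ T.singularValues (K - 1) ^ 2 := by
      refine le_sq_singularValues_of_forall_mem T (K - 1) U (by omega) _ fun x hx => ?_
      have hb := hg x hx
      have hn := hN x
      have h2 : ‖B x‖ ≤ ‖T x‖ + ‖N x‖ := by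
        have : B x = T x - N x := by simp [hT]
        rw [this]; exact norm_sub_le _ _
      have h3 : ‖B x‖ ^ 2 ≤ 2 * ‖T x‖ ^ 2 + 2 * ‖N x‖ ^ 2 := by
        nlinarith [sq_nonneg (‖T x‖ - ‖N x‖), norm_nonneg (B x)]
      nlinarith
    have h2 : (c₀ * ((n : ℝ) + p) * S) ≤ c₀ * ((n : ℝ) + p) * Fr := by gcongr
    have h3 : 0 ≤ T.singularValues (K - 1) ^ 2 := sq_nonneg _
    calc c₀ * ((n : ℝ) + p) * S ≤ c₀ * ((n : ℝ) + p) * Fr := h2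
      _ < n * p * (g / 2 - s) / (1 + ν) := by
          rw [lt_div_iff₀ (by positivity)]; linarith
      _ ≤ n * p * T.singularValues (K - 1) ^ 2 / (1 + ν) := by gcongr
      _ = T.singularValues (K - 1) ^ 2 * (n * p / (1 + ν)) := by ring
      _ ≤ _ := by gcongr
  have hupp : T.singularValues K ^ 2 * (n * p - c₀ * ((n : ℝ) + p) * K) <
      c₀ * ((n : ℝ) + p) * S := by
    have h1 : T.singularValues K ^ 2 ≤ s := by
      have h := singularValues_add_le_of_finrank_range_le N B K 0 hB
      rw [zero_add] at h
      refine le_trans ?_ (hsv 0)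
      gcongr
      exact T.singularValues_nonneg _
    -- With `e = c₀(n+p)`, the strict step below amounts to `np s + eKs < e Fr`. Bounding `eK` by
    -- `np` explains the factor `2` in `hnoise`.
    have hpK : c₀ * ((n : ℝ) + p) * K ≤ n * p := by linarith
    have h2 : c₀ * ((n : ℝ) + p) * (Fr - 2 * K * s) ≤ c₀ * ((n : ℝ) + p) * S := by gcongr
    calc T.singularValues K ^ 2 * (n * p - c₀ * ((n : ℝ) + p) * K)
        ≤ s * (n * p - c₀ * ((n : ℝ) + p) * K) := by gcongr
      _ < c₀ * ((n : ℝ) + p) * (Fr - 2 * K * s) := by nlinarith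
      _ ≤ _ := h2
  have hanti : Antitone fun j => T.singularValues j ^ 2 := fun i j hij => by
    have := T.singularValues_antitone hij
    have := T.singularValues_nonneg j
    dsimp only
    gcongr
  have hfinal := tail_ratio_lt hanti (m := p) (Kb := maxRank c₀ ν n p) (N₀ := n * p)
    (e := c₀ * ((n : ℝ) + p)) hmax (fun j hj => lt_of_lt_of_le hq (hD j hj))
    hK1 hK hlow hupp hk.1 hne
  have h := hk.2 K hK
  rw [rankCriterion_eq, rankCriterion_eq, hX] at h
  exact absurd h (not_le.2 hfinal)

end RankSelection

/-! ### Quadratic forms and ordered eigenvalues -/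

section Spectral

open Module

theorem inner_toEuclideanLin_transpose {m d : ℕ} (A : Matrix (Fin m) (Fin d) ℝ)
    (x : EuclideanSpace ℝ (Fin m)) (y : EuclideanSpace ℝ (Fin d)) :
    inner ℝ (Matrix.toEuclideanLin A y) x = inner ℝ y (Matrix.toEuclideanLin A.transpose x) := by
  rw [← Matrix.conjTranspose_eq_transpose_of_trivial,
    Matrix.toEuclideanLin_conjTranspose_eq_adjoint, LinearMap.adjoint_inner_right]

/-- A symmetric operator is bounded below by its `K`-th eigenvalue on the span of the top `K`
eigenvectors. -/
theorem exists_submodule_eigDesc_mul_le {d K : ℕ} {M : Matrix (Fin d) (Fin d) ℝ}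
    (hM : M.IsHermitian) (hK1 : 1 ≤ K) (hK : K ≤ d) :
    ∃ U : Submodule ℝ (EuclideanSpace ℝ (Fin d)), K ≤ finrank ℝ U ∧
      ∀ x ∈ U, eigDesc M K * ‖x‖ ^ 2 ≤ inner ℝ x (Matrix.toEuclideanLin M x) := by
  classical
  have hS := Matrix.isSymmetric_toEuclideanLin_iff.mpr hM
  set b := hS.eigenvectorBasis finrank_euclideanSpace with hb
  -- `U` is taken as the kernel of the remaining `d - K` eigencoordinates, so rank-nullity gives its
  -- dimension.
  let L : EuclideanSpace ℝ (Fin d) →ₗ[ℝ]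
      ({j : Fin (Fintype.card (Fin d)) // K ≤ (j : ℕ)} → ℝ) :=
    LinearMap.pi fun j => innerₛₗ ℝ (b j)
  refine ⟨LinearMap.ker L, ?_, fun x hx => ?_⟩
  · have h1 := L.finrank_range_add_finrank_ker
    have h2 : finrank ℝ (LinearMap.range L) ≤ d - K := by
      refine (Submodule.finrank_le _).trans ?_
      rw [finrank_fintype_fun_eq_card]
      simpa using Fintype.card_le_of_injective
        (fun j : {j : Fin (Fintype.card (Fin d)) // K ≤ (j : ℕ)} =>
          (⟨j.1 - K, by
            have := j.2; have := j.1.2; simp only [Fintype.card_fin] at this; omega⟩ :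
            Fin (d - K)))
        (fun a b h => by
          have h' : (a.1 : ℕ) - K = b.1 - K := by simpa using congrArg Fin.val h
          have := a.2; have := b.2
          ext; omega)
    rw [finrank_euclideanSpace_fin] at h1
    omega
  · rw [← b.sum_inner_mul_inner x, ← b.sum_sq_inner_right x, Finset.mul_sum]
    refine Finset.sum_le_sum fun j _ => ?_
    have h1 : inner ℝ (b j) (Matrix.toEuclideanLin M x) =
        hM.eigenvalues₀ j * inner ℝ (b j) x := by
      rw [← hS, hb, hS.apply_eigenvectorBasis finrank_euclideanSpace, inner_smul_left]
      simp [Matrix.IsHermitian.eigenvalues₀]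
    rw [h1, real_inner_comm (b j) x]
    rcases lt_or_ge (j : ℕ) K with h | h
    · have h2 : eigDesc M K ≤ hM.eigenvalues₀ j := by
        unfold eigDesc
        rw [dif_pos ⟨hM, hK1, hK⟩]
        refine hM.eigenvalues₀_antitone ?_
        rw [Fin.le_def]
        simp only
        omega
      nlinarith [sq_nonneg (inner ℝ (b j) x)]
    · have h3 : inner ℝ (b j) x = 0 := congrFun (show L x = 0 from hx) ⟨j, h⟩
      simp [h3]

theorem inner_toEuclideanLin_eq_sum {d : ℕ} {M : Matrix (Fin d) (Fin d) ℝ} (hM : M.IsHermitian)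
    (x : EuclideanSpace ℝ (Fin d)) :
    inner ℝ x (Matrix.toEuclideanLin M x) =
      ∑ j, hM.eigenvalues j * inner ℝ (hM.eigenvectorBasis j) x ^ 2 := by
  have hS := Matrix.isSymmetric_toEuclideanLin_iff.mpr hM
  rw [← hM.eigenvectorBasis.sum_inner_mul_inner x]
  refine Finset.sum_congr rfl fun j _ => ?_
  have h1 : Matrix.toEuclideanLin M (hM.eigenvectorBasis j) =
      hM.eigenvalues j • hM.eigenvectorBasis j := by
    rw [Matrix.toLpLin_apply, hM.mulVec_eigenvectorBasis j]
    rfl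
  rw [← hS, h1, inner_smul_left, real_inner_comm]
  simp; ring

theorem eigenvalues_le_eigDesc_one {d : ℕ} {M : Matrix (Fin d) (Fin d) ℝ} (hM : M.IsHermitian)
    (j : Fin d) : hM.eigenvalues j ≤ eigDesc M 1 := by
  have hd : 1 ≤ d := by have := j.2; omega
  unfold eigDesc
  rw [dif_pos ⟨hM, le_rfl, hd⟩]
  refine hM.eigenvalues₀_antitone ?_
  rw [Fin.le_def]
  simp

theorem trace_eq_sum_eigenvalues_real {d : ℕ} {M : Matrix (Fin d) (Fin d) ℝ}
    (hM : M.IsHermitian) : M.trace = ∑ j, hM.eigenvalues j := by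
  simpa using hM.trace_eq_sum_eigenvalues

end Spectral

/-! ### Centred samples and the signal-plus-noise decomposition -/

section CenteredRows

open Module

variable {E : Type*} [NormedAddCommGroup E] [InnerProductSpace ℝ E]

/-- The linear map `x ↦ (⟪w i, x⟫)ᵢ` whose matrix has rows `w i`. -/
noncomputable def rowMap {n : ℕ} (w : Fin n → E) : E →ₗ[ℝ] EuclideanSpace ℝ (Fin n) :=
  (WithLp.linearEquiv 2 ℝ (Fin n → ℝ)).symm.toLinearMap ∘ₗ
    LinearMap.pi fun i => innerₛₗ ℝ (w i)

theorem rowMap_apply {n : ℕ} (w : Fin n → E) (x : E) (i : Fin n) :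
    rowMap w x i = inner ℝ (w i) x := rfl

theorem norm_sq_rowMap {n : ℕ} (w : Fin n → E) (x : E) :
    ‖rowMap w x‖ ^ 2 = ∑ i, inner ℝ (w i) x ^ 2 := by
  rw [EuclideanSpace.real_norm_sq_eq]
  rfl

/-- A family of vectors minus its average. -/
noncomputable def centered {n : ℕ} (w : Fin n → E) (i : Fin n) : E :=
  w i - (n : ℝ)⁻¹ • ∑ j, w j

theorem sum_sq_sub_average {n : ℕ} (hn : 0 < n) (a : Fin n → ℝ) :
    ∑ i, (a i - (n : ℝ)⁻¹ * ∑ j, a j) ^ 2 = ∑ i, a i ^ 2 - (n : ℝ)⁻¹ * (∑ j, a j) ^ 2 := by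
  have hn' : (n : ℝ) ≠ 0 := by positivity
  simp_rw [sub_sq, Finset.sum_add_distrib, Finset.sum_sub_distrib]
  rw [← Finset.sum_mul, ← Finset.mul_sum]
  simp
  field_simp
  ring

theorem inner_centered {n : ℕ} (w : Fin n → E) (i : Fin n) (x : E) :
    inner ℝ (centered w i) x = inner ℝ (w i) x - (n : ℝ)⁻¹ * ∑ j, inner ℝ (w j) x := by
  rw [centered, inner_sub_left, inner_smul_left, sum_inner]
  simp

theorem norm_sq_rowMap_centered_le {n : ℕ} (hn : 0 < n) (w : Fin n → E) (x : E) :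
    ‖rowMap (centered w) x‖ ^ 2 ≤ ∑ i, inner ℝ (w i) x ^ 2 := by
  rw [norm_sq_rowMap]
  simp_rw [inner_centered]
  rw [sum_sq_sub_average hn]
  have : 0 ≤ (n : ℝ)⁻¹ * (∑ j, inner ℝ (w j) x) ^ 2 := by positivity
  linarith

theorem sum_norm_sq_centered {n : ℕ} (hn : 0 < n) (w : Fin n → E) :
    ∑ i, ‖centered w i‖ ^ 2 = ∑ i, ‖w i‖ ^ 2 - (n : ℝ)⁻¹ * ‖∑ i, w i‖ ^ 2 := by
  have hn' : (n : ℝ) ≠ 0 := by positivity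
  have h : ∀ i, ‖centered w i‖ ^ 2 = ‖w i‖ ^ 2 - 2 * ((n : ℝ)⁻¹ * inner ℝ (w i) (∑ j, w j)) +
      (n : ℝ)⁻¹ ^ 2 * ‖∑ j, w j‖ ^ 2 := fun i => by
    rw [centered, norm_sub_sq_real, inner_smul_right, norm_smul, mul_pow]
    simp
  simp_rw [h, Finset.sum_add_distrib, Finset.sum_sub_distrib]
  rw [← Finset.mul_sum, ← Finset.mul_sum, ← sum_inner, real_inner_self_eq_norm_sq]
  simp
  field_simp
  ring

theorem sum_norm_sq_rowMap_basis {d n : ℕ} (w : Fin n → EuclideanSpace ℝ (Fin d)) :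
    ∑ j ∈ Finset.range d, (rowMap w).singularValues j ^ 2 = ∑ i, ‖w i‖ ^ 2 := by
  have h := sum_sq_singularValues_eq_sum_norm_sq (rowMap w) (EuclideanSpace.basisFun (Fin d) ℝ)
  rw [finrank_euclideanSpace_fin] at h
  rw [h]
  simp_rw [norm_sq_rowMap]
  rw [Finset.sum_comm]
  exact Finset.sum_congr rfl fun i _ => (EuclideanSpace.basisFun (Fin d) ℝ).sum_sq_inner_left _

/-- Centring subtracts the row average from noise and signal separately. The second summand factors
through `ℝ^K`, which is where the rank bound comes from. -/
theorem toEuclideanLin_centering_mul_dataMatrix {n p K : ℕ} (A : Matrix (Fin p) (Fin K) ℝ)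
    (z : Fin n → EuclideanSpace ℝ (Fin K)) (w : Fin n → EuclideanSpace ℝ (Fin p)) :
    Matrix.toEuclideanLin (centering n * dataMatrix A z w) =
      rowMap (centered w) + rowMap (centered z) ∘ₗ Matrix.toEuclideanLin A.transpose := by
  refine LinearMap.ext fun x => PiLp.ext fun i => ?_
  have hmul : Matrix.toEuclideanLin (centering n * dataMatrix A z w) x i =
      (centering n).mulVec ((dataMatrix A z w).mulVec x) i := by
    rw [Matrix.mulVec_mulVec]; rfl
  have hrow : ∀ i, (dataMatrix A z w).mulVec x i =
      inner ℝ (z i) (Matrix.toEuclideanLin A.transpose x) + inner ℝ (w i) x := fun i => by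
    rw [← inner_toEuclideanLin_transpose, ← inner_add_left]
    simp only [PiLp.inner_apply, Matrix.mulVec, dotProduct, dataMatrix, Matrix.of_apply]
    exact Finset.sum_congr rfl fun j _ => by simp [mul_comm]
  rw [hmul, LinearMap.add_apply, PiLp.add_apply, LinearMap.comp_apply, rowMap_apply, rowMap_apply,
    inner_centered, inner_centered, centering, Matrix.sub_mulVec, Matrix.one_mulVec,
    funext hrow]
  simp only [Pi.sub_apply, Matrix.smul_mulVec, Pi.smul_apply, Matrix.mulVec, dotProduct,
    Matrix.of_apply, one_mul, smul_eq_mul, Finset.sum_add_distrib]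
  ring

/-- Deterministic conclusion on the good event. Here `l` and `t` stand for `λ_1` and the trace of
the noise covariance, `L` for the operator-norm constant, and `τ` for the conditioning of the
design. The previous criterion is applied with `s = L(nl + t)` and `g = τ n λ_K`. -/
theorem IsRankEstimate.eq_of_bounds {n p K : ℕ} {L C₂ c₀ ν τ : ℝ} (hL : 0 ≤ L) (hC₂ : 0 < C₂)
    (hc₀ : 1 ≤ c₀) (hc₀' : 8 * L * (1 / C₂ + 1) < c₀) (hν : 0 < ν) (hτ : 0 < τ)
    (hn : 0 < n) (hp : 0 < p) (hK1 : 1 ≤ K) (hKp : K ≤ p) (hK : K ≤ maxRank c₀ ν n p)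
    {A : Matrix (Fin p) (Fin K) ℝ} {SZ : Matrix (Fin K) (Fin K) ℝ} (hSZ : SZ.IsHermitian)
    {l t : ℝ} (hl : 0 < l) (ht : 0 < t) (htl : t ≤ p * l)
    (hre : C₂ * ((min n p : ℕ) : ℝ) * l ≤ t)
    (hsnr : 4 * (L + 2 * (1 + ν) * c₀) / τ * (l + t / n) ≤ eigDesc (A * SZ * A.transpose) K)
    {z : Fin n → EuclideanSpace ℝ (Fin K)} {w : Fin n → EuclideanSpace ℝ (Fin p)}
    (hop : ∀ x, ∑ i, inner ℝ (w i) x ^ 2 ≤ L * (n * l + t) * ‖x‖ ^ 2)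
    (hlow : ∑ i, ‖w i‖ ^ 2 ≥ n * t / 2) (hup : ∑ i, ‖w i‖ ^ 2 ≤ 3 / 2 * (n * t))
    (hmean : (n : ℝ)⁻¹ * ‖∑ i, w i‖ ^ 2 ≤ n * t / 4)
    (hz : ∀ u, τ * n * inner ℝ u (Matrix.toEuclideanLin SZ u) ≤
      ∑ i, inner ℝ (centered z i) u ^ 2)
    {k : ℕ} (hk : IsRankEstimate c₀ ν (dataMatrix A z w) k) : k = K := by
  have hn' : (0 : ℝ) < n := by exact_mod_cast hn
  have hp' : (0 : ℝ) < p := by exact_mod_cast hp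
  have hM : (A * SZ * A.transpose).IsHermitian := by
    have := Matrix.isHermitian_mul_mul_conjTranspose A hSZ
    rwa [Matrix.conjTranspose_eq_transpose_of_trivial] at this
  obtain ⟨U, hU, hUe⟩ := exists_submodule_eigDesc_mul_le hM hK1 hKp
  have hF : ∑ j ∈ Finset.range p, (rowMap (centered w)).singularValues j ^ 2 =
      ∑ i, ‖w i‖ ^ 2 - (n : ℝ)⁻¹ * ‖∑ i, w i‖ ^ 2 := by
    rw [sum_norm_sq_rowMap_basis, sum_norm_sq_centered hn]
  have hFlow : n * t / 4 ≤ ∑ j ∈ Finset.range p, (rowMap (centered w)).singularValues j ^ 2 := by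
    rw [hF]; linarith
  have hFup : ∑ j ∈ Finset.range p, (rowMap (centered w)).singularValues j ^ 2 ≤
      3 / 2 * (n * t) := by
    rw [hF]
    have : 0 ≤ (n : ℝ)⁻¹ * ‖∑ i, w i‖ ^ 2 := by positivity
    linarith
  set Fr := ∑ j ∈ Finset.range p, (rowMap (centered w)).singularValues j ^ 2
  set q := eigDesc (A * SZ * A.transpose) K
  refine IsRankEstimate.eq_of_signal_noise (s := L * (n * l + t)) (g := τ * n * q) hc₀ hν hn hp hK1
    hK (rowMap (centered w)) (rowMap (centered z) ∘ₗ Matrix.toEuclideanLin A.transpose)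
    (toEuclideanLin_centering_mul_dataMatrix A z w) ?_ (by positivity)
    (fun x => (norm_sq_rowMap_centered_le hn w x).trans (hop x)) U hU ?_ ?_ ?_ hk
  · refine (Submodule.finrank_mono (LinearMap.range_comp_le_range _ _)).trans ?_
    simpa using LinearMap.finrank_range_le (rowMap (centered z))
  · intro x hx
    rw [LinearMap.comp_apply, norm_sq_rowMap]
    refine le_trans ?_ (hz _)
    have h1 := hUe x hx
    have h2 : inner ℝ x (Matrix.toEuclideanLin (A * SZ * A.transpose) x) =
        inner ℝ (Matrix.toEuclideanLin A.transpose x)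
          (Matrix.toEuclideanLin SZ (Matrix.toEuclideanLin A.transpose x)) := by
      have h3 := inner_toEuclideanLin_transpose A x
        (Matrix.toEuclideanLin SZ (Matrix.toEuclideanLin A.transpose x))
      rw [real_inner_comm (Matrix.toEuclideanLin SZ _), ← h3, real_inner_comm]
      congr 1
      simp [Matrix.toLpLin_apply, Matrix.mulVec_mulVec, Matrix.mul_assoc]
    rw [← h2, mul_assoc]
    exact mul_le_mul_of_nonneg_left h1 (by positivity)
  -- Noise condition: `np ≤ (n+p)(n∧p)`, and the effective rank gives `(n∧p) l ≤ t/C₂`. The `8` in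
  -- `hc₀'` is the `2` of `hnoise` times the `4` of `Fr ≥ nt/4`.
  · have hmin1 : (n : ℝ) * p ≤ (n + p) * ((min n p : ℕ) : ℝ) := by
      rcases le_total n p with h | h
      · rw [min_eq_left h]; nlinarith
      · rw [min_eq_right h]; nlinarith
    have hmin2 : ((min n p : ℕ) : ℝ) ≤ n := by exact_mod_cast min_le_left n p
    set m : ℝ := ((min n p : ℕ) : ℝ)
    have hm0 : 0 ≤ m := by positivity
    have h1 : m * l ≤ t / C₂ := by rw [le_div_iff₀ hC₂]; linarith
    have h2 : m * (n * l + t) ≤ n * t * (1 / C₂ + 1) := by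
      have h3 : m * t ≤ n * t := by gcongr
      have h4 : n * (m * l) ≤ n * (t / C₂) := by gcongr
      calc m * (n * l + t) = n * (m * l) + m * t := by ring
        _ ≤ n * (t / C₂) + n * t := by gcongr
        _ = _ := by field_simp
    have hnt : 0 < n * t := by positivity
    calc 2 * ((n : ℝ) * p) * (L * (n * l + t))
        ≤ 2 * ((n + p) * m) * (L * (n * l + t)) := by gcongr
      _ = (n + p) * (2 * L * (m * (n * l + t))) := by ring
      _ ≤ (n + p) * (2 * L * (n * t * (1 / C₂ + 1))) := by gcongr
      _ = (n + p) * ((8 * L * (1 / C₂ + 1)) * (n * t / 4)) := by ring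
      _ < (n + p) * (c₀ * (n * t / 4)) := by gcongr
      _ ≤ (n + p) * (c₀ * Fr) := by gcongr
      _ = c₀ * (n + p) * Fr := by ring
  -- Signal condition: `t ≤ pl` turns `(n+p)nt` into at most `npD`. Half of the bound in `hsnr` is
  -- `2L + 4(1+ν)c₀` times `D`, which exceeds the required `L + (3/2)(1+ν)c₀`.
  · set D := n * l + t with hD
    have hDpos : 0 < D := by positivity
    have h1 : ((n : ℝ) + p) * (n * t) ≤ n * p * D := by
      have : (n : ℝ) * n * t ≤ n * n * (p * l) := by gcongr
      rw [hD]; nlinarith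
    have h2 : 4 * (L + 2 * (1 + ν) * c₀) * D ≤ τ * n * q := by
      have e : l + t / n = D / n := by rw [hD]; field_simp
      rw [e, div_mul_div_comm, div_le_iff₀ (by positivity)] at hsnr
      linarith
    calc (1 + ν) * (c₀ * ((n : ℝ) + p) * Fr)
        ≤ (1 + ν) * (c₀ * ((n : ℝ) + p) * (3 / 2 * (n * t))) := by gcongr
      _ = (1 + ν) * c₀ * (3 / 2) * (((n : ℝ) + p) * (n * t)) := by ring
      _ ≤ (1 + ν) * c₀ * (3 / 2) * (n * p * D) := by gcongr
      _ = n * p * ((1 + ν) * c₀ * (3 / 2) * D) := by ring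
      _ < n * p * (τ * n * q / 2 - L * D) := by
          gcongr
          have : 0 < (1 + ν) * c₀ * D := by positivity
          have : 0 ≤ L * D := by positivity
          nlinarith

end CenteredRows

/-! ### Nets of the unit ball -/

section Nets

open Module

variable {E : Type*} [NormedAddCommGroup E] [NormedSpace ℝ E] [FiniteDimensional ℝ E]

/-- The packing bound `5^d` concerns `1`-separated sets in the ball of radius `2`, hence the
dilation by `2`. -/
theorem card_le_of_half_separated (s : Finset E) (hs : ∀ x ∈ s, ‖x‖ ≤ 1)
    (h : ∀ x ∈ s, ∀ y ∈ s, x ≠ y → 1 / 2 ≤ ‖x - y‖) : s.card ≤ 5 ^ finrank ℝ E := by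
  classical
  have hinj : Function.Injective fun x : E => (2 : ℝ) • x :=
    smul_right_injective E two_ne_zero
  rw [← Finset.card_image_of_injective s hinj]
  refine Besicovitch.card_le_of_separated _ ?_ ?_
  · simp only [Finset.mem_image, forall_exists_index, and_imp, forall_apply_eq_imp_iff₂]
    intro x hx
    rw [norm_smul]
    have := hs x hx
    norm_num; linarith
  · simp only [Finset.mem_image, forall_exists_index, and_imp, forall_apply_eq_imp_iff₂]
    intro x hx y hy hne
    have := h x hx y hy fun e => hne (by rw [e])
    rw [← smul_sub, norm_smul]
    norm_num; linarith

variable (E)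

theorem exists_half_net : ∃ N : Finset E, N.card ≤ 5 ^ finrank ℝ E ∧ (∀ y ∈ N, ‖y‖ ≤ 1) ∧
    ∀ x : E, ‖x‖ ≤ 1 → ∃ y ∈ N, ‖x - y‖ ≤ 1 / 2 := by
  classical
  by_contra! hcon
  -- If no separated set were a net, each could be enlarged by a point, contradicting the packing
  -- bound.
  have key : ∀ m : ℕ, ∃ s : Finset E, s.card = m ∧ (∀ x ∈ s, ‖x‖ ≤ 1) ∧
      ∀ x ∈ s, ∀ y ∈ s, x ≠ y → 1 / 2 ≤ ‖x - y‖ := by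
    intro m
    induction m with
    | zero => exact ⟨∅, by simp⟩
    | succ m ih =>
      obtain ⟨s, hm, hs, hsep⟩ := ih
      obtain ⟨x, hx, hxs⟩ := hcon s (card_le_of_half_separated s hs hsep) hs
      have hxn : x ∉ s := fun h => by
        have := hxs x h
        rw [sub_self, norm_zero] at this
        norm_num at this
      refine ⟨insert x s, by rw [Finset.card_insert_of_notMem hxn, hm], ?_, ?_⟩
      · intro y hy
        rcases Finset.mem_insert.1 hy with rfl | hy
        · exact hx
        · exact hs y hy
      · intro y hy z hz hne
        rcases Finset.mem_insert.1 hy with rfl | hy' <;> rcases Finset.mem_insert.1 hz with rfl | hz'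
        · exact absurd rfl hne
        · exact (hxs z hz').le
        · rw [norm_sub_rev]; exact (hxs y hy').le
        · exact hsep y hy' z hz' hne
  obtain ⟨s, hm, hs, hsep⟩ := key (5 ^ finrank ℝ E + 1)
  have := card_le_of_half_separated s hs hsep
  omega

/-- Each refinement approximates the rescaled residual by the half-net, so each halving of the mesh
costs one factor `5^d`. -/
theorem exists_dyadic_net (k : ℕ) : ∃ N : Finset E, N.card ≤ 5 ^ (k * finrank ℝ E) ∧
    ∀ x : E, ‖x‖ ≤ 1 → ∃ y ∈ N, ‖x - y‖ ≤ (1 / 2) ^ k := by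
  classical
  obtain ⟨N₁, hc₁, -, hN₁⟩ := exists_half_net E
  induction k with
  | zero => exact ⟨{0}, by simp, fun x hx => ⟨0, by simp, by simpa using hx⟩⟩
  | succ k ih =>
    obtain ⟨N, hc, hN⟩ := ih
    refine ⟨(N ×ˢ N₁).image fun z => z.1 + ((1 : ℝ) / 2) ^ k • z.2, ?_, ?_⟩
    · refine Finset.card_image_le.trans ?_
      rw [Finset.card_product, add_mul, one_mul, pow_add]
      exact Nat.mul_le_mul hc hc₁
    · intro x hx
      obtain ⟨y, hy, hxy⟩ := hN x hx
      obtain ⟨z, hz, hyz⟩ := hN₁ ((2 : ℝ) ^ k • (x - y)) (by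
        rw [norm_smul, norm_pow, Real.norm_ofNat]
        calc (2 : ℝ) ^ k * ‖x - y‖ ≤ 2 ^ k * (1 / 2) ^ k := by gcongr
          _ = 1 := by rw [← mul_pow]; norm_num)
      refine ⟨_, Finset.mem_image.2 ⟨(y, z), Finset.mem_product.2 ⟨hy, hz⟩, rfl⟩, ?_⟩
      have e : x - (y + ((1 : ℝ) / 2) ^ k • z) =
          ((1 : ℝ) / 2) ^ k • ((2 : ℝ) ^ k • (x - y) - z) := by
        rw [smul_sub, smul_smul, ← mul_pow]
        norm_num
        abel
      rw [e, norm_smul, pow_succ, norm_pow]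
      gcongr
      norm_num

variable {E}

/-- Approximating a unit vector in the net gives `‖T‖ ≤ a + ‖T‖/2`, and the last term is absorbed.
-/
theorem norm_apply_le_of_half_net {F : Type*} [NormedAddCommGroup F] [NormedSpace ℝ F]
    (T : E →ₗ[ℝ] F) {N : Finset E} (hN : ∀ x : E, ‖x‖ ≤ 1 → ∃ y ∈ N, ‖x - y‖ ≤ 1 / 2)
    {a : ℝ} (ha : 0 ≤ a) (h : ∀ y ∈ N, ‖T y‖ ≤ a) (x : E) : ‖T x‖ ≤ 2 * a * ‖x‖ := by
  set T' := LinearMap.toContinuousLinearMap T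
  have h1 : ‖T'‖ ≤ a + ‖T'‖ * (1 / 2) := by
    refine T'.opNorm_le_of_unit_norm (by positivity) fun x hx => ?_
    obtain ⟨y, hy, hxy⟩ := hN x hx.le
    have e : T' x = T y + T' (x - y) := by
      change T x = T y + T (x - y)
      rw [← map_add]; congr 1; abel
    rw [e]
    refine (norm_add_le _ _).trans ?_
    gcongr
    · exact h y hy
    · exact (T'.le_opNorm _).trans (by gcongr)
  have h2 : ‖T'‖ ≤ 2 * a := by linarith
  exact (T'.le_opNorm x).trans (by gcongr)

end Nets

/-! ### One-dimensional Gaussian integrals -/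

section GaussianIntegrals

theorem lintegral_exp_mul_gaussianReal (a : ℝ) :
    ∫⁻ x, ENNReal.ofReal (Real.exp (a * x)) ∂gaussianReal 0 1 =
      ENNReal.ofReal (Real.exp (a ^ 2 / 2)) := by
  rw [← ofReal_integral_eq_lintegral_ofReal (integrable_exp_mul_gaussianReal a)
    (ae_of_all _ fun x => (Real.exp_pos _).le)]
  have := mgf_gaussianReal (p := gaussianReal 0 1) (X := id) (μ := 0) (v := 1) (by simp) a
  simp only [mgf, id] at this
  rw [this]
  simp

theorem lintegral_gaussianReal (f : ℝ → ℝ) (hf : Measurable f) :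
    ∫⁻ x, ENNReal.ofReal (f x) ∂gaussianReal 0 1 =
      ∫⁻ x, ENNReal.ofReal ((√(2 * Real.pi))⁻¹ * Real.exp (-x ^ 2 / 2) * f x) := by
  rw [gaussianReal_of_var_ne_zero _ one_ne_zero, lintegral_withDensity_eq_lintegral_mul₀
    (measurable_gaussianPDF 0 1).aemeasurable (by fun_prop)]
  refine lintegral_congr fun x => ?_
  simp only [Pi.mul_apply, gaussianPDF]
  rw [← ENNReal.ofReal_mul (gaussianPDFReal_nonneg _ _ _)]
  simp [gaussianPDFReal]

/-- The integral equals `(1 - 2a)^{-1/2}`, and `(1 - 2a)(1 + 4a) ≥ 1` exactly when `0 ≤ a ≤ 1/4`. -/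
theorem lintegral_exp_mul_sq_gaussianReal_le {a : ℝ} (ha : 0 ≤ a) (ha' : a ≤ 1 / 4) :
    ∫⁻ x, ENNReal.ofReal (Real.exp (a * x ^ 2)) ∂gaussianReal 0 1 ≤
      ENNReal.ofReal (Real.exp (2 * a)) := by
  have hb : 0 < 1 / 2 - a := by linarith
  have e : ∀ x : ℝ, (√(2 * Real.pi))⁻¹ * Real.exp (-x ^ 2 / 2) * Real.exp (a * x ^ 2) =
      (√(2 * Real.pi))⁻¹ * Real.exp (-(1 / 2 - a) * x ^ 2) := fun x => by
    rw [mul_assoc, ← Real.exp_add]; ring_nf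
  rw [lintegral_gaussianReal _ (by fun_prop)]
  simp_rw [e]
  rw [← ofReal_integral_eq_lintegral_ofReal ((integrable_exp_neg_mul_sq hb).const_mul _)
    (ae_of_all _ fun x => by positivity), integral_const_mul, integral_gaussian]
  refine ENNReal.ofReal_le_ofReal ?_
  rw [← Real.sqrt_inv, ← Real.sqrt_mul (by positivity)]
  refine Real.sqrt_le_iff.2 ⟨(Real.exp_pos _).le, ?_⟩
  have h1 : (2 * Real.pi)⁻¹ * (Real.pi / (1 / 2 - a)) = 1 / (1 - 2 * a) := by
    have := Real.pi_pos.ne'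
    have : 1 - 2 * a ≠ 0 := by linarith
    field_simp
  rw [h1, div_le_iff₀ (by linarith), ← Real.exp_nat_mul]
  have h2 := Real.add_one_le_exp (4 * a)
  have h3 : Real.exp (((2 : ℕ) : ℝ) * (2 * a)) = Real.exp (4 * a) := by push_cast; ring_nf
  rw [h3]
  nlinarith

/-- Bounding the Gaussian density by its maximum leaves a translation-invariant integral, so the
bound is uniform in `a`. The rate `2` makes it equal to `1/2`. -/
theorem lintegral_exp_neg_two_mul_sq_sub_gaussianReal_le (a : ℝ) :
    ∫⁻ x, ENNReal.ofReal (Real.exp (-2 * (x - a) ^ 2)) ∂gaussianReal 0 1 ≤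
      ENNReal.ofReal (1 / 2) := by
  rw [lintegral_gaussianReal _ (by fun_prop)]
  have h1 : Integrable fun x : ℝ => (√(2 * Real.pi))⁻¹ * Real.exp (-2 * (x - a) ^ 2) :=
    ((integrable_exp_neg_mul_sq (b := 2) two_pos).comp_sub_right a).const_mul _
  calc _ ≤ ∫⁻ x, ENNReal.ofReal ((√(2 * Real.pi))⁻¹ * Real.exp (-2 * (x - a) ^ 2)) := by
        refine lintegral_mono fun x => ENNReal.ofReal_le_ofReal ?_
        gcongr
        refine mul_le_of_le_one_right (by positivity) (Real.exp_le_one_iff.2 ?_)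
        nlinarith [sq_nonneg x]
    _ = ENNReal.ofReal (1 / 2) := by
        rw [← ofReal_integral_eq_lintegral_ofReal h1 (ae_of_all _ fun x => by positivity),
          integral_const_mul, integral_sub_right_eq_self (fun x => Real.exp (-2 * x ^ 2)) a,
          integral_gaussian, ← Real.sqrt_inv, ← Real.sqrt_mul (by positivity)]
        congr 1
        have : (2 * Real.pi)⁻¹ * (Real.pi / 2) = (1 / 2) ^ 2 := by
          have := Real.pi_pos.ne'
          field_simp
        rw [this, Real.sqrt_sq (by norm_num)]

end GaussianIntegrals

/-! ### Exponential moments and the noise operator norm -/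

section ExponentialMoments

open Module

variable {Ω : Type*} [MeasurableSpace Ω] {μ : Measure Ω}
  {E : Type*} [NormedAddCommGroup E] [InnerProductSpace ℝ E] [FiniteDimensional ℝ E]
  [MeasurableSpace E] [BorelSpace E] {ι : Type*} [Fintype ι]

theorem lintegral_prod_pi_gaussianReal (f : ι → ℝ → ENNReal) (hf : ∀ i, Measurable (f i)) :
    ∫⁻ g, ∏ i, f i (g i) ∂Measure.pi (fun _ : ι => gaussianReal 0 1) =
      ∏ i, ∫⁻ x, f i x ∂gaussianReal 0 1 := by
  have h1 : iIndepFun (fun i (g : ι → ℝ) => f i (g i))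
      (Measure.pi (fun _ : ι => gaussianReal 0 1)) :=
    iIndepFun_pi fun i => (hf i).aemeasurable
  rw [lintegral_prod_eq_prod_lintegral_of_indepFun Finset.univ
    (fun i (g : ι → ℝ) => f i (g i)) h1 fun i => (hf i).comp (measurable_pi_apply i)]
  refine Finset.prod_congr rfl fun i _ => ?_
  have h2 := measurePreserving_eval (fun _ : ι => gaussianReal 0 1) i
  exact h2.lintegral_comp (hf i)

theorem lintegral_exp_sum_mul_pi_gaussianReal (a : ι → ℝ) :
    ∫⁻ g, ENNReal.ofReal (Real.exp (∑ i, a i * g i)) ∂Measure.pi (fun _ : ι => gaussianReal 0 1) =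
      ENNReal.ofReal (Real.exp ((∑ i, a i ^ 2) / 2)) := by
  have e : ∀ g : ι → ℝ, ENNReal.ofReal (Real.exp (∑ i, a i * g i)) =
      ∏ i, ENNReal.ofReal (Real.exp (a i * g i)) := fun g => by
    rw [Real.exp_sum, ENNReal.ofReal_prod_of_nonneg fun i _ => (Real.exp_pos _).le]
  simp_rw [e]
  rw [lintegral_prod_pi_gaussianReal (fun i x => ENNReal.ofReal (Real.exp (a i * x)))
    fun i => by fun_prop]
  simp_rw [lintegral_exp_mul_gaussianReal]
  rw [← ENNReal.ofReal_prod_of_nonneg fun i _ => (Real.exp_pos _).le, ← Real.exp_sum,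
    Finset.sum_div]

theorem lintegral_exp_sum_sq_pi_gaussianReal_le (a : ι → ℝ) (ha : ∀ i, 0 ≤ a i)
    (ha' : ∀ i, a i ≤ 1 / 4) :
    ∫⁻ g, ENNReal.ofReal (Real.exp (∑ i, a i * g i ^ 2))
      ∂Measure.pi (fun _ : ι => gaussianReal 0 1) ≤
      ENNReal.ofReal (Real.exp (2 * ∑ i, a i)) := by
  have e : ∀ g : ι → ℝ, ENNReal.ofReal (Real.exp (∑ i, a i * g i ^ 2)) =
      ∏ i, ENNReal.ofReal (Real.exp (a i * g i ^ 2)) := fun g => by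
    rw [Real.exp_sum, ENNReal.ofReal_prod_of_nonneg fun i _ => (Real.exp_pos _).le]
  simp_rw [e]
  rw [lintegral_prod_pi_gaussianReal (fun i x => ENNReal.ofReal (Real.exp (a i * x ^ 2)))
    fun i => by fun_prop, Finset.mul_sum, Real.exp_sum,
    ENNReal.ofReal_prod_of_nonneg fun i _ => (Real.exp_pos _).le]
  exact Finset.prod_le_prod' fun i _ => lintegral_exp_mul_sq_gaussianReal_le (ha i) (ha' i)

/-- The exponential moment of the squared norm of a sub-Gaussian vector whose variance proxy is
diagonal in the orthonormal basis `b` with entries `l`. -/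
theorem lintegral_exp_mul_norm_sq_le [SFinite μ] {ξ : Ω → E} (hξ : Measurable ξ)
    (b : OrthonormalBasis ι ℝ E) {l : ι → ℝ} (hl : ∀ j, 0 ≤ l j)
    (h : ∀ u, ∫⁻ ω, ENNReal.ofReal (Real.exp (inner ℝ u (ξ ω))) ∂μ ≤
      ENNReal.ofReal (Real.exp ((∑ j, l j * inner ℝ (b j) u ^ 2) / 2)))
    {s : ℝ} (hs : 0 ≤ s) (hsl : ∀ j, s * l j ≤ 1 / 4) :
    ∫⁻ ω, ENNReal.ofReal (Real.exp (s * ‖ξ ω‖ ^ 2)) ∂μ ≤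
      ENNReal.ofReal (Real.exp (2 * (s * ∑ j, l j))) := by
  set r := √(2 * s) with hr
  have hr2 : r ^ 2 = 2 * s := Real.sq_sqrt (by positivity)
  set γ := Measure.pi (fun _ : ι => gaussianReal 0 1)
  let v : (ι → ℝ) → E := fun g => ∑ j, (r * g j) • b j
  have hv : Measurable v := by fun_prop
  have hbv : ∀ g j, inner ℝ (b j) (v g) = r * g j := fun g j => by
    rw [b.orthonormal.inner_right_fintype]
  -- Gaussian linearisation: `exp(s‖ξ‖²)` is the average of `exp⟨v(g), ξ⟩` over a standard Gaussian
  -- `g`, because `r²/2 = s`. After Tonelli the sub-Gaussian bound applies for fixed `g` and leaves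
  -- a Gaussian chi-square moment.
  have e1 : ∀ ω, ENNReal.ofReal (Real.exp (s * ‖ξ ω‖ ^ 2)) =
      ∫⁻ g, ENNReal.ofReal (Real.exp (inner ℝ (v g) (ξ ω))) ∂γ := fun ω => by
    have e2 : ∀ g, inner ℝ (v g) (ξ ω) = ∑ j, (r * inner ℝ (b j) (ξ ω)) * g j := fun g => by
      rw [sum_inner]
      refine Finset.sum_congr rfl fun j _ => ?_
      rw [inner_smul_left]
      simp; ring
    simp_rw [e2]
    rw [lintegral_exp_sum_mul_pi_gaussianReal]
    congr 2
    simp_rw [mul_pow]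
    rw [← Finset.mul_sum, hr2, b.sum_sq_inner_right]
    ring
  have hmeas : Measurable fun z : Ω × (ι → ℝ) =>
      ENNReal.ofReal (Real.exp (inner ℝ (v z.2) (ξ z.1))) := by
    fun_prop
  calc ∫⁻ ω, ENNReal.ofReal (Real.exp (s * ‖ξ ω‖ ^ 2)) ∂μ
      = ∫⁻ ω, ∫⁻ g, ENNReal.ofReal (Real.exp (inner ℝ (v g) (ξ ω))) ∂γ ∂μ :=
        lintegral_congr e1
    _ = ∫⁻ g, ∫⁻ ω, ENNReal.ofReal (Real.exp (inner ℝ (v g) (ξ ω))) ∂μ ∂γ :=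
        lintegral_lintegral_swap hmeas.aemeasurable
    _ ≤ ∫⁻ g, ENNReal.ofReal (Real.exp (∑ j, s * l j * g j ^ 2)) ∂γ := by
        refine lintegral_mono fun g => (h (v g)).trans_eq ?_
        simp_rw [hbv]
        congr 2
        rw [Finset.sum_div]
        refine Finset.sum_congr rfl fun j _ => ?_
        rw [mul_pow, hr2]; ring
    _ ≤ ENNReal.ofReal (Real.exp (2 * ∑ j, s * l j)) :=
        lintegral_exp_sum_sq_pi_gaussianReal_le _ (fun j => mul_nonneg hs (hl j)) hsl
    _ = _ := by rw [← Finset.mul_sum]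

theorem lintegral_exp_inner_le {H : Type*} [NormedAddCommGroup H] [InnerProductSpace ℝ H]
    {ξ : Ω → H} {Q : ℝ≥0} {u : H}
    (h : HasSubgaussianMGF (fun ω => inner ℝ u (ξ ω)) Q μ) :
    ∫⁻ ω, ENNReal.ofReal (Real.exp (inner ℝ u (ξ ω))) ∂μ ≤
      ENNReal.ofReal (Real.exp (Q / 2)) := by
  have h1 := h.integrable_exp_mul 1
  have h2 := h.mgf_le 1
  simp only [mgf, one_mul, one_pow, mul_one] at h1 h2
  rw [← ofReal_integral_eq_lintegral_ofReal h1 (ae_of_all _ fun x => (Real.exp_pos _).le)]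
  exact ENNReal.ofReal_le_ofReal h2

theorem measure_ge_le_of_lintegral_exp_le {X : Ω → ℝ} (hX : Measurable X) {s a x : ℝ}
    (hs : 0 ≤ s) (h : ∫⁻ ω, ENNReal.ofReal (Real.exp (s * X ω)) ∂μ ≤ ENNReal.ofReal (Real.exp a)) :
    μ {ω | x ≤ X ω} ≤ ENNReal.ofReal (Real.exp (a - s * x)) := by
  have h1 := meas_ge_le_lintegral_div (μ := μ)
    (f := fun ω => ENNReal.ofReal (Real.exp (s * X ω))) (by fun_prop)
    (ε := ENNReal.ofReal (Real.exp (s * x)))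
    (by simp [Real.exp_pos]) ENNReal.ofReal_ne_top
  calc μ {ω | x ≤ X ω}
      ≤ μ {ω | ENNReal.ofReal (Real.exp (s * x)) ≤ ENNReal.ofReal (Real.exp (s * X ω))} := by
        refine measure_mono fun ω hω => ?_
        refine ENNReal.ofReal_le_ofReal (Real.exp_le_exp.2 ?_)
        exact mul_le_mul_of_nonneg_left hω hs
    _ ≤ _ := h1
    _ ≤ ENNReal.ofReal (Real.exp a) / ENNReal.ofReal (Real.exp (s * x)) := by gcongr
    _ = _ := by rw [← ENNReal.ofReal_div_of_pos (Real.exp_pos _), Real.exp_sub]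

/-- A unit-norm combination of independent sub-Gaussian vectors is sub-Gaussian with the same
variance proxy. -/
theorem lintegral_exp_inner_sum_smul_le {n : ℕ} {W : Fin n → Ω → E}
    (hind : iIndepFun W μ) {Q : E → ℝ≥0}
    (hQ : ∀ i u, HasSubgaussianMGF (fun ω => inner ℝ u (W i ω)) (Q u) μ)
    {v : Fin n → ℝ} (hv : ∑ i, v i ^ 2 ≤ 1) (u : E) :
    ∫⁻ ω, ENNReal.ofReal (Real.exp (inner ℝ u (∑ i, v i • W i ω))) ∂μ ≤
      ENNReal.ofReal (Real.exp (Q u / 2)) := by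
  have h1 : iIndepFun (fun i ω => v i * inner ℝ u (W i ω)) μ :=
    hind.comp (fun i x => v i * inner ℝ u x) fun i => by fun_prop
  have h2 := HasSubgaussianMGF.sum_of_iIndepFun h1 (s := Finset.univ)
    fun i _ => (hQ i u).const_mul (v i)
  have e : ∀ ω, inner ℝ u (∑ i, v i • W i ω) = ∑ i, v i * inner ℝ u (W i ω) := fun ω => by
    simp_rw [inner_sum, inner_smul_right]
  have h3 := lintegral_exp_inner_le (ξ := fun ω => ∑ i, v i • W i ω) (u := u)
    (by simp_rw [e]; exact h2)
  refine h3.trans (ENNReal.ofReal_le_ofReal (Real.exp_le_exp.2 ?_))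
  gcongr
  rw [← NNReal.coe_le_coe, NNReal.coe_sum]
  change ∑ i, v i ^ 2 * (Q u : ℝ) ≤ Q u
  rw [← Finset.sum_mul]
  exact mul_le_of_le_one_left (Q u).2 hv

/-- Dimension-free bound for the operator norm of a matrix with independent sub-Gaussian rows. -/
theorem measure_exists_sum_sq_inner_gt_le [IsProbabilityMeasure μ] {n : ℕ} {W : Fin n → Ω → E}
    (hW : ∀ i, Measurable (W i)) (hind : iIndepFun W μ) {Q : E → ℝ≥0}
    (hQ : ∀ i u, HasSubgaussianMGF (fun ω => inner ℝ u (W i ω)) (Q u) μ)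
    (b : OrthonormalBasis ι ℝ E) {l : ι → ℝ} (hl : ∀ j, 0 ≤ l j)
    (hQl : ∀ u, (Q u : ℝ) = ∑ j, l j * inner ℝ (b j) u ^ 2) {Λ : ℝ} (hΛ : 0 < Λ)
    (hlΛ : ∀ j, l j ≤ Λ) :
    μ {ω | ∃ x, 48 * (n * Λ + ∑ j, l j) * ‖x‖ ^ 2 < ∑ i, inner ℝ (W i ω) x ^ 2} ≤
      ENNReal.ofReal (Real.exp (-n)) := by
  set t := ∑ j, l j with ht
  have ht0 : 0 ≤ t := Finset.sum_nonneg fun j _ => hl j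
  obtain ⟨N, hNc, hN1, hN⟩ := exists_half_net (EuclideanSpace ℝ (Fin n))
  rw [finrank_euclideanSpace_fin] at hNc
  -- With `s = 1/(4Λ)` the Chernoff exponent is `2st - s(2t + 12nΛ) = -3n`, which beats the net
  -- cardinality `5^n ≤ e^{2n}`.
  have hpt : ∀ v : EuclideanSpace ℝ (Fin n), ‖v‖ ≤ 1 →
      μ {ω | 2 * t + 12 * (n * Λ) ≤ ‖∑ i, v i • W i ω‖ ^ 2} ≤
        ENNReal.ofReal (Real.exp (-(3 * n))) := by
    intro v hv
    have hv' : ∑ i, v i ^ 2 ≤ 1 := by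
      rw [← EuclideanSpace.real_norm_sq_eq]
      exact pow_le_one₀ (norm_nonneg _) hv
    have hm : Measurable fun ω => ∑ i, v i • W i ω :=
      Finset.measurable_sum _ fun i _ => (hW i).const_smul (v i)
    have h1 := lintegral_exp_mul_norm_sq_le hm b hl (μ := μ) (fun u => by
      rw [← hQl]; exact lintegral_exp_inner_sum_smul_le hind hQ hv' u)
      (s := 1 / (4 * Λ)) (by positivity) (fun j => by
        rw [div_mul_eq_mul_div, one_mul, div_le_iff₀ (by positivity)]
        have := hlΛ j
        linarith)
    have h2 := measure_ge_le_of_lintegral_exp_le (X := fun ω => ‖∑ i, v i • W i ω‖ ^ 2)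
      (by fun_prop) (by positivity) h1 (x := 2 * t + 12 * (n * Λ))
    refine h2.trans_eq ?_
    congr 2
    field_simp
    ring
  have hcover : {ω | ∃ x, 48 * (n * Λ + t) * ‖x‖ ^ 2 < ∑ i, inner ℝ (W i ω) x ^ 2} ⊆
      ⋃ v ∈ N, {ω | 2 * t + 12 * (n * Λ) ≤ ‖∑ i, v i • W i ω‖ ^ 2} := by
    intro ω hω
    by_contra hcon
    simp only [Set.mem_iUnion, Set.mem_ofPred_eq, not_exists, not_le] at hcon
    obtain ⟨x, hx⟩ := hω
    -- Passing to the adjoint puts the net in `ℝ^n`. The net doubles the norm bound, so `48 = 2² ·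
    -- 12`.
    set T := (rowMap fun i => W i ω).adjoint with hT
    have hTv : ∀ v : EuclideanSpace ℝ (Fin n), T v = ∑ i, v i • W i ω := fun v => by
      refine ext_inner_right ℝ fun y => ?_
      rw [hT, LinearMap.adjoint_inner_left, sum_inner, PiLp.inner_apply]
      refine Finset.sum_congr rfl fun i _ => ?_
      rw [rowMap_apply, inner_smul_left]
      simp [mul_comm]
    set a := √(12 * (n * Λ + t)) with ha
    have ha2 : a ^ 2 = 12 * (n * Λ + t) := Real.sq_sqrt (by positivity)
    have hTN : ∀ y ∈ N, ‖T y‖ ≤ a := fun y hy => by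
      refine Real.le_sqrt_of_sq_le ?_
      rw [hTv]
      have := hcon y hy
      linarith
    have hTall := norm_apply_le_of_half_net T hN (Real.sqrt_nonneg _) hTN
    set y := rowMap (fun i => W i ω) x with hy
    have h1 : ‖y‖ ^ 2 ≤ 2 * a * ‖y‖ * ‖x‖ := by
      calc ‖y‖ ^ 2 = inner ℝ (T y) x := by
            rw [hT, LinearMap.adjoint_inner_left, ← hy, real_inner_self_eq_norm_sq]
        _ ≤ ‖T y‖ * ‖x‖ := real_inner_le_norm _ _
        _ ≤ _ := by gcongr; exact hTall y
    have h2 : ‖y‖ ≤ 2 * a * ‖x‖ := by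
      rcases eq_or_lt_of_le (norm_nonneg y) with h | h
      · rw [← h]; positivity
      · nlinarith
    have h3 : ‖y‖ ^ 2 ≤ 48 * (n * Λ + t) * ‖x‖ ^ 2 := by
      calc ‖y‖ ^ 2 ≤ (2 * a * ‖x‖) ^ 2 := by gcongr
        _ = 4 * a ^ 2 * ‖x‖ ^ 2 := by ring
        _ = _ := by rw [ha2]; ring
    rw [hy, norm_sq_rowMap] at h3
    linarith
  calc _ ≤ ∑ v ∈ N, μ {ω | 2 * t + 12 * (n * Λ) ≤ ‖∑ i, v i • W i ω‖ ^ 2} :=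
        (measure_mono hcover).trans (measure_biUnion_finset_le _ _)
    _ ≤ ∑ _v ∈ N, ENNReal.ofReal (Real.exp (-(3 * n))) :=
        Finset.sum_le_sum fun v hv => hpt v (hN1 v hv)
    _ = ENNReal.ofReal (N.card * Real.exp (-(3 * n))) := by
        rw [Finset.sum_const, nsmul_eq_mul, ENNReal.ofReal_mul (by positivity),
          ENNReal.ofReal_natCast]
    _ ≤ _ := by
        refine ENNReal.ofReal_le_ofReal ?_
        have h5 : (5 : ℝ) ≤ Real.exp 2 := by
          have h := Real.add_one_le_exp 1
          have h1 : Real.exp 2 = Real.exp 1 * Real.exp 1 := by rw [← Real.exp_add]; norm_num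
          have := Real.exp_one_gt_d9
          rw [h1]; nlinarith
        have hc : (N.card : ℝ) ≤ Real.exp (2 * n) := by
          calc (N.card : ℝ) ≤ (5 : ℝ) ^ n := by exact_mod_cast hNc
            _ ≤ Real.exp 2 ^ n := by gcongr
            _ = Real.exp (2 * n) := by rw [← Real.exp_nat_mul]; ring_nf
        calc N.card * Real.exp (-(3 * n)) ≤ Real.exp (2 * n) * Real.exp (-(3 * n)) := by gcongr
          _ = Real.exp (-n) := by rw [← Real.exp_add]; ring_nf

end ExponentialMoments

/-! ### Concentration of the total noise energy -/

section NormConcentration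

variable {Ω : Type*} [MeasurableSpace Ω] {μ : Measure Ω}

theorem exp_half_le_two : Real.exp (1 / 2) ≤ 2 := by
  have h1 : Real.exp (1 / 2) ^ 2 = Real.exp 1 := by rw [← Real.exp_nat_mul]; norm_num
  have h2 := Real.exp_one_lt_d9
  nlinarith [Real.exp_pos (1 / 2)]

/-- Uses `y²/2 ≤ e^y` at `y = X/(4T)`, together with `e^{1/2} ≤ 2`. -/
theorem integrable_sq_of_lintegral_exp_le {X : Ω → ℝ} (hX : Measurable X) (hX0 : ∀ ω, 0 ≤ X ω)
    {T : ℝ} (hT : 0 < T)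
    (h : ∫⁻ ω, ENNReal.ofReal (Real.exp (1 / (4 * T) * X ω)) ∂μ ≤
      ENNReal.ofReal (Real.exp (1 / 2))) :
    Integrable (fun ω => X ω ^ 2) μ ∧ ∫ ω, X ω ^ 2 ∂μ ≤ 64 * T ^ 2 := by
  have hint : Integrable (fun ω => Real.exp (1 / (4 * T) * X ω)) μ := by
    refine ⟨by fun_prop, ?_⟩
    rw [hasFiniteIntegral_iff_ofReal (ae_of_all _ fun _ => (Real.exp_pos _).le)]
    exact h.trans_lt ENNReal.ofReal_lt_top
  have hle : ∀ ω, X ω ^ 2 ≤ 32 * T ^ 2 * Real.exp (1 / (4 * T) * X ω) := fun ω => by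
    have h1 : 0 ≤ 1 / (4 * T) * X ω := mul_nonneg (by positivity) (hX0 ω)
    have h2 := Real.quadratic_le_exp_of_nonneg h1
    have h3 : X ω ^ 2 = 32 * T ^ 2 * ((1 / (4 * T) * X ω) ^ 2 / 2) := by
      field_simp
      ring
    rw [h3]
    gcongr
    linarith
  have hint2 : Integrable (fun ω => X ω ^ 2) μ :=
    (hint.const_mul (32 * T ^ 2)).mono' (by fun_prop) (ae_of_all _ fun ω => by
      rw [Real.norm_of_nonneg (sq_nonneg _)]; exact hle ω)
  refine ⟨hint2, ?_⟩
  calc ∫ ω, X ω ^ 2 ∂μ ≤ ∫ ω, 32 * T ^ 2 * Real.exp (1 / (4 * T) * X ω) ∂μ :=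
        integral_mono hint2 (hint.const_mul _) hle
    _ = 32 * T ^ 2 * ∫ ω, Real.exp (1 / (4 * T) * X ω) ∂μ := integral_const_mul _ _
    _ ≤ 32 * T ^ 2 * 2 := by
        gcongr
        rw [← ofReal_integral_eq_lintegral_ofReal hint (ae_of_all _ fun _ => (Real.exp_pos _).le)]
          at h
        exact ((ENNReal.ofReal_le_ofReal_iff (Real.exp_pos _).le).1 h).trans exp_half_le_two
    _ = 64 * T ^ 2 := by ring

/-- Concentration of the total squared norm of independent sub-Gaussian vectors, and smallness of
the squared norm of their average. -/
theorem measure_norm_sq_sum_bounds_le [IsProbabilityMeasure μ]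
    {E : Type*} [NormedAddCommGroup E] [InnerProductSpace ℝ E] [FiniteDimensional ℝ E]
    [MeasurableSpace E] [BorelSpace E] {ι : Type*} [Fintype ι]
    {n : ℕ} (hn : 0 < n) {W : Fin n → Ω → E}
    (hW : ∀ i, Measurable (W i)) (hind : iIndepFun W μ) {Q : E → ℝ≥0}
    (hQ : ∀ i u, HasSubgaussianMGF (fun ω => inner ℝ u (W i ω)) (Q u) μ)
    (b : OrthonormalBasis ι ℝ E) {l : ι → ℝ} (hl : ∀ j, 0 ≤ l j)
    (hQl : ∀ u, (Q u : ℝ) = ∑ j, l j * inner ℝ (b j) u ^ 2) {t κ : ℝ} (ht : 0 < t) (hκ : 0 < κ)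
    (hlt : ∑ j, l j = κ * t) (hmean : ∀ i, ∫ ω, ‖W i ω‖ ^ 2 ∂μ = t) :
    μ {ω | ¬(n * t / 2 ≤ ∑ i, ‖W i ω‖ ^ 2 ∧ ∑ i, ‖W i ω‖ ^ 2 ≤ 3 / 2 * (n * t) ∧
      (n : ℝ)⁻¹ * ‖∑ i, W i ω‖ ^ 2 ≤ n * t / 4)} ≤
      ENNReal.ofReal ((256 * κ ^ 2 + 32 * κ) / n) := by
  have hn' : (0 : ℝ) < n := by exact_mod_cast hn
  set T := ∑ j, l j with hT
  have hT0 : 0 < T := by rw [hlt]; positivity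
  -- Used twice: coordinate vectors `v` give the fourth moments of single observations, and `v =
  -- n^{-1/2}(1,…,1)` gives the average.
  have hexp : ∀ v : Fin n → ℝ, ∑ i, v i ^ 2 ≤ 1 →
      ∫⁻ ω, ENNReal.ofReal (Real.exp (1 / (4 * T) * ‖∑ i, v i • W i ω‖ ^ 2)) ∂μ ≤
        ENNReal.ofReal (Real.exp (1 / 2)) := fun v hv => by
    have hm : Measurable fun ω => ∑ i, v i • W i ω :=
      Finset.measurable_sum _ fun i _ => (hW i).const_smul (v i)
    have h1 := lintegral_exp_mul_norm_sq_le hm b hl (μ := μ) (fun u => by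
      rw [← hQl]; exact lintegral_exp_inner_sum_smul_le hind hQ hv u)
      (s := 1 / (4 * T)) (by positivity) (fun j => by
        rw [div_mul_eq_mul_div, one_mul, div_le_iff₀ (by positivity)]
        have := Finset.single_le_sum (f := l) (fun j _ => hl j) (Finset.mem_univ j)
        linarith)
    refine h1.trans_eq ?_
    congr 2
    rw [← hT]
    field_simp
    norm_num
  have hX : ∀ i, Integrable (fun ω => (‖W i ω‖ ^ 2) ^ 2) μ ∧
      ∫ ω, (‖W i ω‖ ^ 2) ^ 2 ∂μ ≤ 64 * T ^ 2 := fun i => by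
    refine integrable_sq_of_lintegral_exp_le (by have := hW i; fun_prop) (fun ω => by positivity)
      hT0 ?_
    have := hexp (Pi.single i 1) (by
      simp [Pi.single_apply])
    simpa [Pi.single_apply, ite_smul] using this
  have hL2 : ∀ i, MemLp (fun ω => ‖W i ω‖ ^ 2) 2 μ := fun i =>
    (memLp_two_iff_integrable_sq (by have := hW i; fun_prop)).2 (hX i).1
  have hvar : ∀ i, Var[fun ω => ‖W i ω‖ ^ 2; μ] ≤ 64 * T ^ 2 := fun i => by
    refine (variance_le_expectation_sq (by have := hW i; fun_prop)).trans ?_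
    exact (hX i).2
  -- Chebyshev: `64 n κ² t² / (nt/2)² = 256 κ²/n`.
  have hcheb : μ {ω | n * t / 2 ≤ |∑ i, ‖W i ω‖ ^ 2 - n * t|} ≤
      ENNReal.ofReal (256 * κ ^ 2 / n) := by
    have hsum : MemLp (∑ i, fun ω => ‖W i ω‖ ^ 2) 2 μ := memLp_finsetSum' _ fun i _ => hL2 i
    have h1 := meas_ge_le_variance_div_sq hsum (c := n * t / 2) (by positivity)
    have h2 : Var[∑ i, fun ω => ‖W i ω‖ ^ 2; μ] = ∑ i, Var[fun ω => ‖W i ω‖ ^ 2; μ] := by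
      refine IndepFun.variance_sum (fun i _ => hL2 i) fun i _ j _ hij => ?_
      exact (hind.indepFun hij).comp (φ := fun x : E => ‖x‖ ^ 2) (ψ := fun x : E => ‖x‖ ^ 2)
        (by fun_prop) (by fun_prop)
    have h3 : μ[∑ i, fun ω => ‖W i ω‖ ^ 2] = n * t := by
      have : (∑ i, fun ω => ‖W i ω‖ ^ 2) = fun ω => ∑ i, ‖W i ω‖ ^ 2 := by ext; simp
      rw [this, integral_finsetSum _ fun i _ => (hL2 i).integrable one_le_two]
      simp [hmean]
    rw [h3] at h1
    simp only [Finset.sum_apply] at h1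
    refine h1.trans (ENNReal.ofReal_le_ofReal ?_)
    rw [h2, div_le_iff₀ (by positivity)]
    calc ∑ i, Var[fun ω => ‖W i ω‖ ^ 2; μ] ≤ ∑ _i : Fin n, 64 * T ^ 2 :=
          Finset.sum_le_sum fun i _ => hvar i
      _ = 256 * κ ^ 2 / n * (n * t / 2) ^ 2 := by
          simp [hlt]; field_simp; norm_num
  have hav : μ {ω | n * t / 4 ≤ (n : ℝ)⁻¹ * ‖∑ i, W i ω‖ ^ 2} ≤ ENNReal.ofReal (32 * κ / n) := by
    have hr : (√(n : ℝ)⁻¹) ^ 2 = (n : ℝ)⁻¹ := Real.sq_sqrt (by positivity)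
    have h1 := hexp (fun _ => √(n : ℝ)⁻¹) (by simp [hn'.ne'])
    have e : ∀ ω, ‖∑ i, √(n : ℝ)⁻¹ • W i ω‖ ^ 2 = (n : ℝ)⁻¹ * ‖∑ i, W i ω‖ ^ 2 := fun ω => by
      rw [← Finset.smul_sum, norm_smul, mul_pow, Real.norm_eq_abs, sq_abs, hr]
    simp_rw [e] at h1
    have hm : Measurable fun ω => ∑ i, W i ω := Finset.measurable_sum _ fun i _ => hW i
    refine (measure_ge_le_of_lintegral_exp_le (X := fun ω => (n : ℝ)⁻¹ * ‖∑ i, W i ω‖ ^ 2)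
      (by fun_prop) (by positivity) h1 (x := n * t / 4)).trans (ENNReal.ofReal_le_ofReal ?_)
    have e2 : 1 / (4 * T) * (n * t / 4) = n / (16 * κ) := by rw [hlt]; field_simp; norm_num
    rw [e2, sub_eq_add_neg, Real.exp_add, Real.exp_neg]
    have h2 := Real.add_one_le_exp (n / (16 * κ))
    have h3 : (0 : ℝ) < n / (16 * κ) := by positivity
    calc Real.exp (1 / 2) * (Real.exp (n / (16 * κ)))⁻¹ ≤ 2 * (n / (16 * κ))⁻¹ := by
          gcongr
          · exact exp_half_le_two
          · linarith
      _ = 32 * κ / n := by field_simp; norm_num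
  have hsub : {ω | ¬(n * t / 2 ≤ ∑ i, ‖W i ω‖ ^ 2 ∧ ∑ i, ‖W i ω‖ ^ 2 ≤ 3 / 2 * (n * t) ∧
      (n : ℝ)⁻¹ * ‖∑ i, W i ω‖ ^ 2 ≤ n * t / 4)} ⊆
      {ω | n * t / 2 ≤ |∑ i, ‖W i ω‖ ^ 2 - n * t|} ∪
        {ω | n * t / 4 ≤ (n : ℝ)⁻¹ * ‖∑ i, W i ω‖ ^ 2} := by
    intro ω hω
    by_contra hcon
    simp only [Set.mem_union, Set.mem_ofPred_eq, not_or, not_le] at hcon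
    obtain ⟨h1, h2⟩ := hcon
    have h3 := abs_lt.1 h1
    exact hω ⟨by linarith, by linarith, h2.le⟩
  calc _ ≤ _ := (measure_mono hsub).trans (measure_union_le _ _)
    _ ≤ ENNReal.ofReal (256 * κ ^ 2 / n) + ENNReal.ofReal (32 * κ / n) := by gcongr
    _ = _ := by rw [← ENNReal.ofReal_add (by positivity) (by positivity), add_div]

end NormConcentration

/-! ### Consequences of the noise model -/

section Noise

variable {Ω : Type*} [MeasurableSpace Ω] {P : Measure Ω} {d : ℕ}

theorem covMat_posSemidef_of_isSubGaussianNoise {γ : ℝ≥0} {W : Ω → EuclideanSpace ℝ (Fin d)}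
    (h : IsSubGaussianNoise P γ W) : (covMat P W).PosSemidef := by
  obtain ⟨S, V, hS, hSS, -⟩ := h
  rw [← hSS]
  have := Matrix.posSemidef_conjTranspose_mul_self S
  rwa [hS.isHermitian.eq] at this

/-- By symmetry of `S`, `⟨u, W⟩ = ⟨S u, V⟩` almost surely, with `‖S u‖² = ⟨u, Σ_W u⟩`. Rescaling to
a unit vector fails only when `S u = 0`, a separate case. -/
theorem IsSubGaussianNoise.hasSubgaussianMGF_inner [IsProbabilityMeasure P] {γ : ℝ≥0}
    {W : Ω → EuclideanSpace ℝ (Fin d)} (h : IsSubGaussianNoise P γ W)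
    (u : EuclideanSpace ℝ (Fin d)) :
    HasSubgaussianMGF (fun ω => inner ℝ u (W ω))
      (γ ^ 2 * (inner ℝ u (Matrix.toEuclideanLin (covMat P W) u)).toNNReal) P := by
  obtain ⟨S, V, hS, hSS, hV, hWV, -, -, hsub⟩ := h
  have hSsym := Matrix.isSymmetric_toEuclideanLin_iff.mpr hS.isHermitian
  set y := Matrix.toEuclideanLin S u with hy
  have hq : inner ℝ u (Matrix.toEuclideanLin (covMat P W) u) = ‖y‖ ^ 2 := by
    have h1 : Matrix.toEuclideanLin (covMat P W) u = Matrix.toEuclideanLin S y := by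
      rw [← hSS, hy]
      simp [Matrix.toLpLin_apply, Matrix.mulVec_mulVec]
    rw [h1, ← hSsym, ← hy, real_inner_self_eq_norm_sq]
  have hae : (fun ω => inner ℝ y (V ω)) =ᵐ[P] fun ω => inner ℝ u (W ω) := by
    filter_upwards [hWV] with ω hω
    rw [hω, hy, hSsym]
  refine HasSubgaussianMGF.congr ?_ hae
  rcases eq_or_ne y 0 with h0 | h0
  · rw [hq, h0]
    simp
  · have hn : ‖y‖ ≠ 0 := norm_ne_zero_iff.2 h0
    have h1 := (hsub (‖y‖⁻¹ • y) (by rw [norm_smul]; simp [hn])).const_mul ‖y‖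
    have e : (fun ω => ‖y‖ * inner ℝ (‖y‖⁻¹ • y) (V ω)) = fun ω => inner ℝ y (V ω) := by
      ext ω
      rw [inner_smul_left]
      simp [hn]
    rw [e] at h1
    convert h1 using 1
    rw [hq, mul_comm]
    congr 1
    exact Real.toNNReal_of_nonneg (sq_nonneg _)

theorem integral_norm_sq_eq_trace_covMat [IsProbabilityMeasure P] {γ : ℝ≥0}
    {W : Ω → EuclideanSpace ℝ (Fin d)} (h : IsSubGaussianNoise P γ W)
    (hW : Integrable W P ∧ ∫ ω, W ω ∂P = 0) :
    ∫ ω, ‖W ω‖ ^ 2 ∂P = (covMat P W).trace := by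
  have hL2 : ∀ i, MemLp (fun ω => W ω i) 2 P := fun i => by
    have h1 := (h.hasSubgaussianMGF_inner (EuclideanSpace.basisFun (Fin d) ℝ i)).memLp 2
    simpa [PiLp.inner_apply] using h1
  have hmean : ∀ i, ∫ ω, W ω i ∂P = 0 := fun i => by
    have h1 := (EuclideanSpace.proj (𝕜 := ℝ) i : EuclideanSpace ℝ (Fin d) →L[ℝ] ℝ).integral_comp_comm
      hW.1
    rw [hW.2] at h1
    simpa using h1
  simp_rw [EuclideanSpace.real_norm_sq_eq]
  rw [integral_finsetSum _ fun i _ => (hL2 i).integrable_sq, Matrix.trace]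
  refine Finset.sum_congr rfl fun i _ => ?_
  simp only [Matrix.diag_apply, covMat, Matrix.of_apply]
  rw [covariance_self (hL2 i).aemeasurable, variance_of_integral_eq_zero (hL2 i).aemeasurable
    (hmean i)]

end Noise

/-! ### Independence over disjoint pairs of observations -/

section DisjointPairs

variable {Ω : Type*} [MeasurableSpace Ω] {μ : Measure Ω} {S : Type*} [MeasurableSpace S]

theorem sum_pairs_le_sum {n m : ℕ} {f g : Fin m → Fin n}
    (hfg : Function.Injective (Sum.elim f g)) {a : Fin n → ℝ} (ha : ∀ i, 0 ≤ a i) :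
    ∑ i, (a (f i) + a (g i)) ≤ ∑ j, a j := by
  classical
  rw [Finset.sum_add_distrib]
  have h1 : ∑ x : Fin m ⊕ Fin m, a (Sum.elim f g x) = ∑ i, a (f i) + ∑ i, a (g i) := by
    rw [Fintype.sum_sum_type]; rfl
  rw [← h1, ← Finset.sum_image (f := a) (g := Sum.elim f g) fun x _ y _ h => hfg h]
  exact Finset.sum_le_univ_sum_of_nonneg ha

/-- Injectivity of `Sum.elim f g` says that all `2m` indices are distinct. The pairs are then
independent blocks, each with law `ρ.prod ρ`, and the integral factorises. -/
theorem lintegral_prod_pairs [IsProbabilityMeasure μ] {n m : ℕ} {f g : Fin m → Fin n}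
    (hfg : Function.Injective (Sum.elim f g)) {ζ : Fin n → Ω → S} (hζ : ∀ i, Measurable (ζ i))
    (hind : iIndepFun ζ μ) {ρ : Measure S} (hlaw : ∀ i, μ.map (ζ i) = ρ)
    {h : S × S → ENNReal} (hh : Measurable h) (s : Finset (Fin m)) :
    ∫⁻ ω, ∏ i ∈ s, h (ζ (f i) ω, ζ (g i) ω) ∂μ = (∫⁻ z, h z ∂ρ.prod ρ) ^ s.card := by
  classical
  induction s using Finset.induction_on with
  | empty => simp
  | insert j s hj ih =>
    have hmeas : ∀ i, Measurable fun ω => h (ζ (f i) ω, ζ (g i) ω) := fun i =>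
      hh.comp ((hζ _).prodMk (hζ _))
    have hdisj : Disjoint ({f j, g j} : Finset (Fin n)) (s.image f ∪ s.image g) := by
      rw [Finset.disjoint_left]
      intro x hx hx'
      have hl : ∀ i, f i = Sum.elim f g (Sum.inl i) := fun _ => rfl
      have hr : ∀ i, g i = Sum.elim f g (Sum.inr i) := fun _ => rfl
      simp only [Finset.mem_insert, Finset.mem_singleton, Finset.mem_union,
        Finset.mem_image] at hx hx'
      rcases hx with rfl | rfl <;> rcases hx' with ⟨i, hi, e⟩ | ⟨i, hi, e⟩ <;>
        simp only [hl, hr] at e <;> have e' := hfg e <;> simp at e' <;> exact hj (e' ▸ hi)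
    have hI := hind.indepFun_finset _ _ hdisj hζ
    have hI2 : IndepFun (fun ω => h (ζ (f j) ω, ζ (g j) ω))
        (fun ω => ∏ i ∈ s, h (ζ (f i) ω, ζ (g i) ω)) μ := by
      let φ : (({f j, g j} : Finset (Fin n)) → S) → ENNReal :=
        fun x => h (x ⟨f j, by simp⟩, x ⟨g j, by simp⟩)
      let ψ : ((s.image f ∪ s.image g : Finset (Fin n)) → S) → ENNReal := fun x =>
        ∏ i ∈ s.attach,
          h (x ⟨f i, Finset.mem_union_left _ (Finset.mem_image_of_mem _ i.2)⟩,
            x ⟨g i, Finset.mem_union_right _ (Finset.mem_image_of_mem _ i.2)⟩)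
      have h1 := hI.comp (φ := φ) (ψ := ψ)
        (hh.comp ((measurable_pi_apply _).prodMk (measurable_pi_apply _)))
        (Finset.measurable_prod _ fun i _ =>
          hh.comp ((measurable_pi_apply _).prodMk (measurable_pi_apply _)))
      have hψ : (fun ω => ∏ i ∈ s, h (ζ (f i) ω, ζ (g i) ω)) =
          ψ ∘ fun ω (i : (s.image f ∪ s.image g : Finset (Fin n))) => ζ i ω :=
        funext fun ω => (Finset.prod_attach s fun i => h (ζ (f i) ω, ζ (g i) ω)).symm
      rw [hψ]
      exact h1
    have hpair : ∫⁻ ω, h (ζ (f j) ω, ζ (g j) ω) ∂μ = ∫⁻ z, h z ∂ρ.prod ρ := by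
      have hne : f j ≠ g j := fun e => by
        have := hfg (show Sum.elim f g (Sum.inl j) = Sum.elim f g (Sum.inr j) from e)
        simp at this
      have h2 := (indepFun_iff_map_prod_eq_prod_map_map (hζ _).aemeasurable
        (hζ _).aemeasurable).1 (hind.indepFun hne)
      rw [hlaw, hlaw] at h2
      rw [← h2, lintegral_map hh ((hζ _).prodMk (hζ _))]
    simp_rw [Finset.prod_insert hj]
    rw [lintegral_mul_eq_lintegral_mul_lintegral_of_indepFun'' (hmeas j).aemeasurable
      (Finset.measurable_prod _ fun i _ => hmeas i).aemeasurable hI2, hpair, ih,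
      Finset.card_insert_of_notMem hj, pow_succ, mul_comm]

end DisjointPairs

/-! ### Increments of equally labelled Gaussian pairs -/

section GaussianPairs

open Module

variable {E : Type*} [NormedAddCommGroup E] [InnerProductSpace ℝ E]

/-- The squared increment along `v` of a pair with equal labels. -/
noncomputable def pairIncrement (v : E) (z : (E × Fin 2) × (E × Fin 2)) : ℝ :=
  if z.1.2 = z.2.2 then inner ℝ v (z.1.1 - z.2.1) ^ 2 else 0

variable [FiniteDimensional ℝ E] [MeasurableSpace E] [BorelSpace E]

theorem map_inner_stdGaussian (v : E) :
    (stdGaussian E).map (fun x => inner ℝ v x) = gaussianReal 0 (‖v‖ ^ 2).toNNReal := by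
  have h := IsGaussian.map_eq_gaussianReal (μ := stdGaussian E) (innerSL ℝ v)
  rw [integral_strongDual_stdGaussian, variance_dual_stdGaussian, innerSL_apply_norm] at h
  exact h

theorem hasSubgaussianMGF_inner_stdGaussian (v : E) :
    HasSubgaussianMGF (fun x => inner ℝ v x) (‖v‖ ^ 2).toNNReal (stdGaussian E) where
  integrable_exp_mul t := by
    have h := integrable_exp_mul_gaussianReal (μ := 0) (v := (‖v‖ ^ 2).toNNReal) t
    rw [← map_inner_stdGaussian] at h
    exact h.comp_measurable (f := fun x => inner ℝ v x) (by fun_prop)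
  mgf_le t := by
    rw [mgf_gaussianReal (map_inner_stdGaussian v)]
    simp

theorem lintegral_exp_neg_two_mul_sq_stdGaussian_le {v : E} (hv : ‖v‖ = 1) (a : ℝ) :
    ∫⁻ x, ENNReal.ofReal (Real.exp (-2 * (inner ℝ v x - a) ^ 2)) ∂stdGaussian E ≤
      ENNReal.ofReal (1 / 2) := by
  have h := lintegral_exp_neg_two_mul_sq_sub_gaussianReal_le a
  have h1 := map_inner_stdGaussian v
  rw [hv] at h1
  simp only [one_pow, Real.toNNReal_one] at h1
  rw [← h1, lintegral_map (by fun_prop) (by fun_prop)] at h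
  exact h

theorem measurable_pairIncrement (v : E) : Measurable (pairIncrement v) := by
  refine Measurable.ite ?_ (by fun_prop) measurable_const
  exact measurableSet_eq_fun (by fun_prop) (by fun_prop)

/-- For equal labels, integrating out one Gaussian gives at most `1/2` wherever the other lies; for
different labels the integrand is `1`. Since `q² + (1-q)² ≥ 1/2`, the total is at most `3/4` for
every label distribution. -/
theorem lintegral_exp_neg_pairIncrement_le {v : E} (hv : ‖v‖ = 1) (ν : Measure (Fin 2))
    [IsProbabilityMeasure ν] :
    ∫⁻ z, ENNReal.ofReal (Real.exp (-2 * pairIncrement v z))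
      ∂((stdGaussian E).prod ν).prod ((stdGaussian E).prod ν) ≤ ENNReal.ofReal (3 / 4) := by
  have hm : Measurable fun z => ENNReal.ofReal (Real.exp (-2 * pairIncrement v z)) := by
    have := measurable_pairIncrement v
    fun_prop
  have hinner : ∀ (y y' : Fin 2) (x' : E),
      ∫⁻ x, ENNReal.ofReal (Real.exp (-2 * pairIncrement v ((x, y), (x', y')))) ∂stdGaussian E ≤
        if y = y' then ENNReal.ofReal (1 / 2) else 1 := by
    intro y y' x'
    simp only [pairIncrement]
    split_ifs with h
    · simp_rw [inner_sub_right]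
      exact lintegral_exp_neg_two_mul_sq_stdGaussian_le hv _
    · simp
  have hν : ν {0} + ν {1} = 1 := by
    have h1 := lintegral_fintype (μ := ν) (fun _ => (1 : ENNReal))
    rw [lintegral_one, measure_univ, Fin.sum_univ_two, one_mul, one_mul] at h1
    exact h1.symm
  obtain ⟨q, hq0, hq1, h0, h1⟩ : ∃ q : ℝ, 0 ≤ q ∧ q ≤ 1 ∧ ν {0} = ENNReal.ofReal q ∧
      ν {1} = ENNReal.ofReal (1 - q) := by
    refine ⟨ν.real {0}, measureReal_nonneg, measureReal_le_one, ?_, ?_⟩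
    · simp
    · have h2 : 1 - ν.real {0} = ν.real {1} := by
        have h3 := congrArg ENNReal.toReal hν
        rw [ENNReal.toReal_add (measure_ne_top _ _) (measure_ne_top _ _)] at h3
        simp only [ENNReal.toReal_one] at h3
        simp only [measureReal_def]
        linarith
      rw [h2]
      simp
  rw [lintegral_prod_symm' _ hm]
  calc _ ≤ ∫⁻ z', ∫⁻ y, (if y = z'.2 then ENNReal.ofReal (1 / 2) else 1) ∂ν
        ∂((stdGaussian E).prod ν) := by
        refine lintegral_mono fun z' => ?_
        rw [lintegral_prod_symm' _ (by exact hm.comp (by fun_prop))]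
        exact lintegral_mono fun y => hinner y z'.2 z'.1
    _ = ∫⁻ y', ∫⁻ y, (if y = y' then ENNReal.ofReal (1 / 2) else 1) ∂ν ∂ν := by
        rw [lintegral_prod_symm' _ (by
          exact (measurable_of_finite (fun y' : Fin 2 =>
            ∫⁻ y, (if y = y' then ENNReal.ofReal (1 / 2) else 1) ∂ν)).comp measurable_snd)]
        simp
    _ ≤ ENNReal.ofReal (3 / 4) := by
        simp only [lintegral_fintype, Fin.sum_univ_two, h0, h1]
        simp only [if_true, zero_ne_one, one_ne_zero, if_false, one_mul]
        rw [← ENNReal.ofReal_mul (by norm_num), ← ENNReal.ofReal_mul (by norm_num),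
          ← ENNReal.ofReal_add (by positivity) (by linarith),
          ← ENNReal.ofReal_add (by positivity) (by linarith),
          ← ENNReal.ofReal_mul (by nlinarith), ← ENNReal.ofReal_mul (by nlinarith),
          ← ENNReal.ofReal_add (by nlinarith) (by nlinarith)]
        refine ENNReal.ofReal_le_ofReal ?_
        nlinarith [sq_nonneg (2 * q - 1)]

end GaussianPairs

/-! ### Uniform lower bound for the Gaussian design -/

section GaussianDesign

open Module

variable {Ω : Type*} [MeasurableSpace Ω] {μ : Measure Ω}
  {E : Type*} [NormedAddCommGroup E] [InnerProductSpace ℝ E]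

/-- Sum of the squared increments along `v` over disjoint pairs with equal labels. -/
noncomputable def pairEnergy {n m : ℕ} (f g : Fin m → Fin n) (ζ : Fin n → E × Fin 2) (v : E) : ℝ :=
  ∑ i, pairIncrement v (ζ (f i), ζ (g i))

theorem pairIncrement_smul (c : ℝ) (v : E) (z : (E × Fin 2) × (E × Fin 2)) :
    pairIncrement (c • v) z = c ^ 2 * pairIncrement v z := by
  simp only [pairIncrement]
  split_ifs
  · rw [inner_smul_left]; simp; ring
  · simp

/-- Transfers a lower bound from a net point `y` to a nearby `v`: termwise, `b²/2 - (a-b)² ≤ a²`. -/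
theorem half_pairEnergy_sub_le {n m : ℕ} (f g : Fin m → Fin n) (ζ : Fin n → E × Fin 2) (v y : E) :
    pairEnergy f g ζ y / 2 - pairEnergy f g ζ (v - y) ≤ pairEnergy f g ζ v := by
  unfold pairEnergy
  rw [Finset.sum_div, ← Finset.sum_sub_distrib]
  refine Finset.sum_le_sum fun i _ => ?_
  simp only [pairIncrement]
  split_ifs
  · rw [inner_sub_left v y]
    set a := inner ℝ v ((ζ (f i)).1 - (ζ (g i)).1)
    set b := inner ℝ y ((ζ (f i)).1 - (ζ (g i)).1)
    nlinarith [sq_nonneg (2 * a - b)]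
  · simp

theorem pairEnergy_le_two_mul_sum {n m : ℕ} {f g : Fin m → Fin n}
    (hfg : Function.Injective (Sum.elim f g)) (ζ : Fin n → E × Fin 2) (v : E) :
    pairEnergy f g ζ v ≤ 2 * ∑ i, inner ℝ (ζ i).1 v ^ 2 := by
  have h := sum_pairs_le_sum hfg (a := fun i => inner ℝ (ζ i).1 v ^ 2) fun i => sq_nonneg _
  refine le_trans ?_ (mul_le_mul_of_nonneg_left h zero_le_two)
  unfold pairEnergy
  rw [Finset.mul_sum]
  refine Finset.sum_le_sum fun i _ => ?_
  simp only [pairIncrement]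
  split_ifs
  · rw [inner_sub_right, real_inner_comm (ζ (f i)).1 v,
      real_inner_comm (ζ (g i)).1 v]
    set a := inner ℝ (ζ (f i)).1 v
    set b := inner ℝ (ζ (g i)).1 v
    nlinarith [sq_nonneg (a + b)]
  · positivity

variable [FiniteDimensional ℝ E] [MeasurableSpace E] [BorelSpace E]

/-- Chernoff at rate `2`: independence gives `(3/4)^m ≤ e^{-4m/15}`, the threshold `m/20` costs
`e^{m/10}`, and `4/15 - 1/10 = 1/6`. -/
theorem measure_pairEnergy_le_le [IsProbabilityMeasure μ] {n m : ℕ} {f g : Fin m → Fin n}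
    (hfg : Function.Injective (Sum.elim f g)) {ζ : Fin n → Ω → E × Fin 2}
    (hζ : ∀ i, Measurable (ζ i)) (hind : iIndepFun ζ μ) {ν : Measure (Fin 2)}
    [IsProbabilityMeasure ν] (hlaw : ∀ i, μ.map (ζ i) = (stdGaussian E).prod ν)
    {v : E} (hv : v ≠ 0) :
    μ {ω | pairEnergy f g (fun i => ζ i ω) v ≤ m / 20 * ‖v‖ ^ 2} ≤
      ENNReal.ofReal (Real.exp (-(m / 6))) := by
  have hv0 : 0 < ‖v‖ := norm_pos_iff.2 hv
  set u := ‖v‖⁻¹ • v with hu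
  have hu1 : ‖u‖ = 1 := by rw [hu, norm_smul]; simp [hv0.ne']
  have hscale : ∀ ω, pairEnergy f g (fun i => ζ i ω) u =
      (‖v‖ ^ 2)⁻¹ * pairEnergy f g (fun i => ζ i ω) v := fun ω => by
    unfold pairEnergy
    rw [Finset.mul_sum]
    refine Finset.sum_congr rfl fun i _ => ?_
    rw [hu, pairIncrement_smul, inv_pow]
  have hmeas : Measurable fun ω => -pairEnergy f g (fun i => ζ i ω) u := by
    refine (Finset.measurable_sum _ fun i _ => ?_).neg
    exact (measurable_pairIncrement u).comp ((hζ _).prodMk (hζ _))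
  have hexp : ∫⁻ ω, ENNReal.ofReal (Real.exp (2 * -pairEnergy f g (fun i => ζ i ω) u)) ∂μ ≤
      ENNReal.ofReal (Real.exp (Real.log (3 / 4) * m)) := by
    have e : ∀ ω, ENNReal.ofReal (Real.exp (2 * -pairEnergy f g (fun i => ζ i ω) u)) =
        ∏ i, ENNReal.ofReal (Real.exp (-2 * pairIncrement u (ζ (f i) ω, ζ (g i) ω))) := fun ω => by
      rw [← ENNReal.ofReal_prod_of_nonneg fun i _ => (Real.exp_pos _).le, ← Real.exp_sum,
        ← Finset.mul_sum]
      congr 2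
      unfold pairEnergy
      ring
    simp_rw [e]
    have hm : Measurable fun z => ENNReal.ofReal (Real.exp (-2 * pairIncrement u z)) := by
      have := measurable_pairIncrement u
      fun_prop
    rw [lintegral_prod_pairs hfg hζ hind hlaw hm, Finset.card_univ, Fintype.card_fin,
      mul_comm, Real.exp_nat_mul, Real.exp_log (by norm_num), ENNReal.ofReal_pow (by norm_num)]
    gcongr
    exact lintegral_exp_neg_pairIncrement_le hu1 ν
  have h := measure_ge_le_of_lintegral_exp_le hmeas zero_le_two hexp (x := -(m / 20))
  refine (measure_mono fun ω hω => ?_).trans (h.trans (ENNReal.ofReal_le_ofReal ?_))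
  · simp only [Set.mem_ofPred_eq, hscale] at hω ⊢
    rw [neg_le_neg_iff, inv_mul_le_iff₀ (by positivity)]
    linarith
  · refine Real.exp_le_exp.2 ?_
    have h1 : Real.log (3 / 4) ≤ -(4 / 15) := by
      have h3 := Real.log_le_log (x := 3 / 4) (y := Real.exp (-(4 / 15))) (by norm_num) (by
        rw [Real.exp_neg, le_inv_comm₀ (by norm_num) (Real.exp_pos _)]
        have h4 : Real.exp (4 / 15) ^ 15 ≤ ((3 : ℝ) / 4)⁻¹ ^ 15 := by
          rw [← Real.exp_nat_mul]
          have h5 : Real.exp (((15 : ℕ) : ℝ) * (4 / 15)) = Real.exp 1 ^ 4 := by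
            rw [← Real.exp_nat_mul]; norm_num
          rw [h5]
          calc Real.exp 1 ^ 4 ≤ 2.7182818286 ^ 4 := by gcongr; exact Real.exp_one_lt_d9.le
            _ ≤ _ := by norm_num
        exact le_of_pow_le_pow_left₀ (by norm_num) (by norm_num) h4)
      rwa [Real.log_exp] at h3
    have hm0 : (0 : ℝ) ≤ m := by positivity
    nlinarith

/-- A Gaussian design with few columns has a well-conditioned within-label pair energy. -/
theorem measure_exists_pairEnergy_lt_le [IsProbabilityMeasure μ] {n m : ℕ} {f g : Fin m → Fin n}
    (hfg : Function.Injective (Sum.elim f g)) (hnm : n ≤ 3 * m) (hK : 1000 * finrank ℝ E ≤ n)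
    {G : Fin n → Ω → E} {Y : Fin n → Ω → Fin 2}
    (hG : ∀ i, Measurable (G i)) (hY : ∀ i, Measurable (Y i))
    (hind : iIndepFun (fun i ω => (G i ω, Y i ω)) μ) {ν : Measure (Fin 2)}
    [IsProbabilityMeasure ν]
    (hlaw : ∀ i, μ.map (fun ω => (G i ω, Y i ω)) = (stdGaussian E).prod ν) :
    μ {ω | ∃ v, pairEnergy f g (fun i => (G i ω, Y i ω)) v < n / 1000 * ‖v‖ ^ 2} ≤
      ENNReal.ofReal (Real.exp (-n) + Real.exp (-(n / 40))) := by
  have hGlaw : ∀ i, μ.map (G i) = stdGaussian E := fun i => by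
    have h1 := congrArg (Measure.map Prod.fst) (hlaw i)
    rw [Measure.map_map measurable_fst ((hG i).prodMk (hY i)), Measure.map_fst_prod,
      measure_univ, one_smul] at h1
    exact h1
  have hGsub : ∀ i u, HasSubgaussianMGF (fun ω => inner ℝ u (G i ω)) (‖u‖ ^ 2).toNNReal μ :=
    fun i u => by
      have h1 := hasSubgaussianMGF_inner_stdGaussian u
      rw [← hGlaw i] at h1
      exact HasSubgaussianMGF.of_map (hG i).aemeasurable h1
  have hop := measure_exists_sum_sq_inner_gt_le hG
    (hind.comp (fun _ z => z.1) fun _ => measurable_fst) hGsub (stdOrthonormalBasis ℝ E)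
    (l := fun _ => 1) (fun _ => zero_le_one) (fun u => by
      rw [Real.coe_toNNReal _ (sq_nonneg _)]
      simp_rw [one_mul]
      exact ((stdOrthonormalBasis ℝ E).sum_sq_inner_right u).symm) one_pos fun _ => le_rfl
  classical
  -- Mesh `2⁻⁹`: the approximation error is at most `192n/2^{18}`, while half the energy at a net
  -- point of norm at least `1/2` is at least `m/160 ≥ n/480`; the gap exceeds `n/1000`. The net has
  -- at most `e^{18K}` points, where `K` is the dimension of `E`, and `18K - m/6 ≤ -n/40`.
  obtain ⟨N, hNc, hN⟩ := exists_dyadic_net E 9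
  have hζ : ∀ i, Measurable fun ω => (G i ω, Y i ω) := fun i => (hG i).prodMk (hY i)
  have hKn : (1000 : ℝ) * finrank ℝ E ≤ n := by exact_mod_cast hK
  have hnm' : (n : ℝ) ≤ 3 * m := by exact_mod_cast hnm
  have hsub : {ω | ∃ v, pairEnergy f g (fun i => (G i ω, Y i ω)) v < n / 1000 * ‖v‖ ^ 2} ⊆
      {ω | ∃ x, 48 * (n * 1 + ∑ _j : Fin (finrank ℝ E), (1 : ℝ)) * ‖x‖ ^ 2 <
        ∑ i, inner ℝ (G i ω) x ^ 2} ∪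
      ⋃ y ∈ N.filter (· ≠ 0),
        {ω | pairEnergy f g (fun i => (G i ω, Y i ω)) y ≤ m / 20 * ‖y‖ ^ 2} := by
    rintro ω ⟨v, hv⟩
    by_contra hcon
    simp only [Set.mem_union, Set.mem_iUnion, Set.mem_ofPred_eq, not_or, not_exists, not_lt,
      not_le, Finset.mem_filter, Finset.sum_const, Finset.card_univ, Fintype.card_fin,
      nsmul_eq_mul, mul_one] at hcon
    obtain ⟨h1, h2⟩ := hcon
    set ζ := fun i => (G i ω, Y i ω)
    have hv0 : v ≠ 0 := by
      rintro rfl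
      simp [pairEnergy, pairIncrement] at hv
    have hvn : 0 < ‖v‖ := norm_pos_iff.2 hv0
    set u := ‖v‖⁻¹ • v with hu
    have hu1 : ‖u‖ = 1 := by rw [hu, norm_smul]; simp [hvn.ne']
    obtain ⟨y, hy, hyu⟩ := hN u hu1.le
    have hy1 : 1 / 2 ≤ ‖y‖ := by
      have h3 : ‖u‖ ≤ ‖u - y‖ + ‖y‖ := by
        simpa using norm_add_le (u - y) y
      have : ((1 : ℝ) / 2) ^ 9 ≤ 1 / 2 := by norm_num
      linarith
    have hy0 : y ≠ 0 := by
      rintro rfl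
      norm_num at hy1
    have h4 := h2 y ⟨hy, hy0⟩
    have h5 := half_pairEnergy_sub_le f g ζ u y
    have h6 := pairEnergy_le_two_mul_sum hfg ζ (u - y)
    have h7 := h1 (u - y)
    have h8 : ‖u - y‖ ^ 2 ≤ 1 / 262144 := by
      calc ‖u - y‖ ^ 2 ≤ (((1 : ℝ) / 2) ^ 9) ^ 2 := by gcongr
        _ = _ := by norm_num
    have h9 : (1 : ℝ) / 4 ≤ ‖y‖ ^ 2 := by nlinarith
    have h10 : 48 * ((n : ℝ) + finrank ℝ E) * ‖u - y‖ ^ 2 ≤ 48 * (2 * n) * (1 / 262144) := by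
      have : (0 : ℝ) ≤ finrank ℝ E := by positivity
      gcongr
      linarith
    have h11 : (m : ℝ) / 20 * (1 / 4) ≤ m / 20 * ‖y‖ ^ 2 := by gcongr
    have h12 : pairEnergy f g ζ u = (‖v‖ ^ 2)⁻¹ * pairEnergy f g ζ v := by
      unfold pairEnergy
      rw [Finset.mul_sum]
      refine Finset.sum_congr rfl fun i _ => ?_
      rw [hu, pairIncrement_smul, inv_pow]
    have h13 : pairEnergy f g ζ u < n / 1000 := by
      rw [h12, inv_mul_lt_iff₀ (by positivity)]
      linarith
    have hn0 : (0 : ℝ) ≤ n := by positivity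
    have h14 : ∑ i, inner ℝ (ζ i).1 (u - y) ^ 2 = ∑ i, inner ℝ (G i ω) (u - y) ^ 2 := rfl
    linarith
  refine (measure_mono hsub).trans ((measure_union_le _ _).trans ?_)
  rw [ENNReal.ofReal_add (Real.exp_pos _).le (Real.exp_pos _).le]
  refine add_le_add hop ?_
  calc _ ≤ ∑ y ∈ N.filter (· ≠ 0),
        μ {ω | pairEnergy f g (fun i => (G i ω, Y i ω)) y ≤ m / 20 * ‖y‖ ^ 2} :=
        measure_biUnion_finset_le _ _
    _ ≤ ∑ _y ∈ N.filter (· ≠ 0), ENNReal.ofReal (Real.exp (-(m / 6))) :=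
        Finset.sum_le_sum fun y hy =>
          measure_pairEnergy_le_le hfg hζ hind hlaw (Finset.mem_filter.1 hy).2
    _ = ENNReal.ofReal ((N.filter (· ≠ 0)).card * Real.exp (-(m / 6))) := by
        rw [Finset.sum_const, nsmul_eq_mul, ENNReal.ofReal_mul (by positivity),
          ENNReal.ofReal_natCast]
    _ ≤ _ := by
        refine ENNReal.ofReal_le_ofReal ?_
        have h5 : (5 : ℝ) ≤ Real.exp 2 := by
          have h1 : Real.exp 2 = Real.exp 1 * Real.exp 1 := by rw [← Real.exp_add]; norm_num
          have := Real.exp_one_gt_d9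
          rw [h1]; nlinarith
        have hc : ((N.filter (· ≠ 0)).card : ℝ) ≤ Real.exp (18 * finrank ℝ E) := by
          calc ((N.filter (· ≠ 0)).card : ℝ) ≤ N.card := by
                exact_mod_cast Finset.card_filter_le _ _
            _ ≤ (5 : ℝ) ^ (9 * finrank ℝ E) := by exact_mod_cast hNc
            _ ≤ Real.exp 2 ^ (9 * finrank ℝ E) := by gcongr
            _ = Real.exp (18 * finrank ℝ E) := by
                rw [← Real.exp_nat_mul]; congr 1; push_cast; ring
        calc ((N.filter (· ≠ 0)).card : ℝ) * Real.exp (-(m / 6))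
            ≤ Real.exp (18 * finrank ℝ E) * Real.exp (-(m / 6)) := by gcongr
          _ = Real.exp (18 * finrank ℝ E + -(m / 6)) := by rw [Real.exp_add]
          _ ≤ _ := Real.exp_le_exp.2 (by linarith)

end GaussianDesign

/-! ### Whitening the latent mixture -/

section Whitening

open scoped MatrixOrder

variable {K : ℕ}

theorem sqrt_isHermitian (S : Matrix (Fin K) (Fin K) ℝ) : (CFC.sqrt S).IsHermitian :=
  (CFC.sqrt_nonneg S).isSelfAdjoint

theorem norm_sq_toEuclideanLin_sqrt {S : Matrix (Fin K) (Fin K) ℝ} (hS : S.PosSemidef)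
    (u : EuclideanSpace ℝ (Fin K)) :
    ‖Matrix.toEuclideanLin (CFC.sqrt S) u‖ ^ 2 = inner ℝ u (Matrix.toEuclideanLin S u) := by
  have h1 := Matrix.isSymmetric_toEuclideanLin_iff.mpr (sqrt_isHermitian S)
  have h2 : Matrix.toEuclideanLin S u =
      Matrix.toEuclideanLin (CFC.sqrt S) (Matrix.toEuclideanLin (CFC.sqrt S) u) := by
    simp [Matrix.toLpLin_apply, Matrix.mulVec_mulVec, CFC.sqrt_mul_sqrt_self S hS.nonneg]
  rw [h2, ← h1, real_inner_self_eq_norm_sq]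

theorem isUnit_det_sqrt {S : Matrix (Fin K) (Fin K) ℝ} (hS : S.PosDef) :
    IsUnit (CFC.sqrt S).det := by
  have h := hS.det_pos.ne'
  rw [← CFC.sqrt_mul_sqrt_self S hS.posSemidef.nonneg, Matrix.det_mul] at h
  exact isUnit_iff_ne_zero.2 (left_ne_zero_of_mul h)

/-- Centring at `a` followed by multiplication with `S^{-1/2}`. -/
noncomputable def whiten (S : Matrix (Fin K) (Fin K) ℝ) (a z : EuclideanSpace ℝ (Fin K)) :
    EuclideanSpace ℝ (Fin K) :=
  Matrix.toEuclideanLin (CFC.sqrt S)⁻¹ (z - a)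

theorem measurable_whiten (S : Matrix (Fin K) (Fin K) ℝ) (a : EuclideanSpace ℝ (Fin K)) :
    Measurable (whiten S a) := by
  have h : Measurable (Matrix.toEuclideanLin (CFC.sqrt S)⁻¹) :=
    (LinearMap.continuous_of_finiteDimensional _).measurable
  exact h.comp (measurable_id.sub_const a)

theorem measurable_whiten_label {T : Type*} [MeasurableSpace T] (S : Matrix (Fin K) (Fin K) ℝ)
    (α : Fin 2 → EuclideanSpace ℝ (Fin K)) {Z : T → EuclideanSpace ℝ (Fin K)} {Y : T → Fin 2}
    (hZ : Measurable Z) (hY : Measurable Y) : Measurable fun ω => whiten S (α (Y ω)) (Z ω) := by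
  have h : Measurable (Matrix.toEuclideanLin (CFC.sqrt S)⁻¹) :=
    (LinearMap.continuous_of_finiteDimensional _).measurable
  exact h.comp (hZ.sub ((measurable_of_finite α).comp hY))

theorem toEuclideanLin_sqrt_whiten {S : Matrix (Fin K) (Fin K) ℝ} (hS : S.PosDef)
    (a z : EuclideanSpace ℝ (Fin K)) :
    Matrix.toEuclideanLin (CFC.sqrt S) (whiten S a z) = z - a := by
  simp [whiten, Matrix.toLpLin_apply, Matrix.mulVec_mulVec,
    Matrix.mul_nonsing_inv _ (isUnit_det_sqrt hS)]

theorem map_whiten_multivariateGaussian {S : Matrix (Fin K) (Fin K) ℝ} (hS : S.PosDef)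
    (a : EuclideanSpace ℝ (Fin K)) :
    (multivariateGaussian a S).map (whiten S a) = stdGaussian (EuclideanSpace ℝ (Fin K)) := by
  rw [multivariateGaussian, Measure.map_map (measurable_whiten S a) (by fun_prop)]
  have h : whiten S a ∘ (fun x => a + Matrix.toEuclideanCLM (𝕜 := ℝ) (CFC.sqrt S) x) = id := by
    ext1 x
    have h1 : Matrix.toEuclideanCLM (𝕜 := ℝ) (CFC.sqrt S) x =
      Matrix.toEuclideanLin (CFC.sqrt S) x := rfl
    rw [Function.comp_apply, h1]
    simp [whiten, Matrix.toLpLin_apply, Matrix.mulVec_mulVec,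
      Matrix.nonsing_inv_mul _ (isUnit_det_sqrt hS)]
  rw [h, Measure.map_id]

/-- The whitened within-class residuals of a Gaussian mixture are standard Gaussian and
independent of the labels. -/
theorem map_whiten_prodMk_label {Ω : Type*} [MeasurableSpace Ω] {P : Measure Ω}
    [IsProbabilityMeasure P] {S : Matrix (Fin K) (Fin K) ℝ} (hS : S.PosDef)
    {α : Fin 2 → EuclideanSpace ℝ (Fin K)} {Z : Ω → EuclideanSpace ℝ (Fin K)} {Y : Ω → Fin 2}
    (hZ : Measurable Z) (hY : Measurable Y)
    (hlaw : ∀ k, (cond P (Y ⁻¹' {k})).map Z = multivariateGaussian (α k) S) :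
    P.map (fun ω => (whiten S (α (Y ω)) (Z ω), Y ω)) =
      (stdGaussian (EuclideanSpace ℝ (Fin K))).prod (P.map Y) := by
  have : IsProbabilityMeasure (P.map Y) := Measure.isProbabilityMeasure_map hY.aemeasurable
  have hG := measurable_whiten_label S α hZ hY
  symm
  refine Measure.prod_eq fun s t hs ht => ?_
  have key : ∀ k, P ((fun ω => whiten S (α (Y ω)) (Z ω)) ⁻¹' s ∩ Y ⁻¹' {k}) =
      stdGaussian (EuclideanSpace ℝ (Fin K)) s * P (Y ⁻¹' {k}) := fun k => by
    have hk : MeasurableSet (Y ⁻¹' {k}) := hY (measurableSet_singleton k)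
    rcases eq_or_ne (P (Y ⁻¹' {k})) 0 with h0 | h0
    · rw [h0, mul_zero]
      exact measure_mono_null Set.inter_subset_right h0
    have h1 : (fun ω => whiten S (α (Y ω)) (Z ω)) ⁻¹' s ∩ Y ⁻¹' {k} =
        Y ⁻¹' {k} ∩ Z ⁻¹' (whiten S (α k) ⁻¹' s) := by
      ext ω
      simp only [Set.mem_inter_iff, Set.mem_preimage, Set.mem_singleton_iff]
      constructor
      · rintro ⟨h, rfl⟩; exact ⟨rfl, h⟩
      · rintro ⟨rfl, h⟩; exact ⟨h, rfl⟩
    rw [h1, ← cond_mul_eq_inter hk _ P, ← Measure.map_apply hZ (measurable_whiten S _ hs),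
      hlaw, ← Measure.map_apply (measurable_whiten S _) hs, map_whiten_multivariateGaussian hS]
  classical
  rw [Measure.map_apply (hG.prodMk hY) (hs.prod ht), Measure.map_apply hY ht]
  have hsum : ∀ A : Set Ω, P (A ∩ Y ⁻¹' t) = ∑ k ∈ Set.toFinset t, P (A ∩ Y ⁻¹' {k}) := fun A => by
    have h1 := sum_measure_preimage_singleton (μ := P.restrict A) (f := Y) (Set.toFinset t)
      fun y _ => hY (measurableSet_singleton y)
    rw [Set.coe_toFinset, Measure.restrict_apply (hY ht)] at h1
    rw [Set.inter_comm, ← h1]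
    refine Finset.sum_congr rfl fun k _ => ?_
    rw [Measure.restrict_apply (hY (measurableSet_singleton k)), Set.inter_comm]
  have h2 := hsum Set.univ
  simp only [Set.univ_inter] at h2
  rw [h2, Finset.mul_sum, Set.mk_preimage_prod]
  exact (hsum _).trans (Finset.sum_congr rfl fun k _ => key k)

/-- Along `S^{1/2}u` an equally labelled whitened difference is `⟨z_f - z_g, u⟩`. Both the class
mean and the sample mean cancel, and `(a-b)²/2 ≤ a² + b²` passes to the centred observations. -/
theorem half_pairEnergy_whiten_le {n m : ℕ} {f g : Fin m → Fin n}
    (hfg : Function.Injective (Sum.elim f g)) {S : Matrix (Fin K) (Fin K) ℝ} (hS : S.PosDef)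
    (α : Fin 2 → EuclideanSpace ℝ (Fin K)) (z : Fin n → EuclideanSpace ℝ (Fin K))
    (y : Fin n → Fin 2) (u : EuclideanSpace ℝ (Fin K)) :
    pairEnergy f g (fun i => (whiten S (α (y i)) (z i), y i))
      (Matrix.toEuclideanLin (CFC.sqrt S) u) / 2 ≤ ∑ i, inner ℝ (centered z i) u ^ 2 := by
  refine le_trans ?_ (sum_pairs_le_sum hfg (a := fun i => inner ℝ (centered z i) u ^ 2)
    fun i => sq_nonneg _)
  unfold pairEnergy
  rw [Finset.sum_div]
  refine Finset.sum_le_sum fun i _ => ?_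
  simp only [pairIncrement]
  split_ifs with h
  · have hsym := Matrix.isSymmetric_toEuclideanLin_iff.mpr (sqrt_isHermitian S)
    rw [hsym, h, map_sub, toEuclideanLin_sqrt_whiten hS, toEuclideanLin_sqrt_whiten hS,
      sub_sub_sub_cancel_right, real_inner_comm]
    have e : inner ℝ (z (f i) - z (g i)) u =
        inner ℝ (centered z (f i)) u - inner ℝ (centered z (g i)) u := by
      rw [← inner_sub_left]; simp [centered]
    rw [e]
    nlinarith [sq_nonneg (inner ℝ (centered z (f i)) u + inner ℝ (centered z (g i)) u)]
  · rw [zero_div]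
    positivity

theorem mul_inner_le_sum_sq_inner_centered {n m : ℕ} {f g : Fin m → Fin n}
    (hfg : Function.Injective (Sum.elim f g)) {S : Matrix (Fin K) (Fin K) ℝ} (hS : S.PosDef)
    {α : Fin 2 → EuclideanSpace ℝ (Fin K)} {z : Fin n → EuclideanSpace ℝ (Fin K)}
    {y : Fin n → Fin 2} {a : ℝ}
    (h : ∀ v, a * ‖v‖ ^ 2 ≤ pairEnergy f g (fun i => (whiten S (α (y i)) (z i), y i)) v)
    (u : EuclideanSpace ℝ (Fin K)) :
    a / 2 * inner ℝ u (Matrix.toEuclideanLin S u) ≤ ∑ i, inner ℝ (centered z i) u ^ 2 := by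
  have h1 := h (Matrix.toEuclideanLin (CFC.sqrt S) u)
  rw [norm_sq_toEuclideanLin_sqrt hS.posSemidef] at h1
  linarith [half_pairEnergy_whiten_le hfg hS α z y u]

end Whitening

/-! ### Assembly of the main theorem -/

theorem exists_disjoint_pairs {n : ℕ} (hn : 2 ≤ n) :
    ∃ (m : ℕ) (f g : Fin m → Fin n), Function.Injective (Sum.elim f g) ∧ n ≤ 3 * m := by
  refine ⟨n / 2, fun i => ⟨i, by omega⟩, fun i => ⟨i + n / 2, by omega⟩, ?_, by omega⟩
  rintro (a | a) (b | b) h <;> simp [Fin.ext_iff] at h <;> first | (congr 1; ext; omega) | omega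

theorem exp_neg_le_inv {x : ℝ} (hx : 0 < x) : Real.exp (-x) ≤ x⁻¹ := by
  rw [Real.exp_neg]
  gcongr
  linarith [Real.add_one_le_exp x]

theorem mainTheorem7 :
    ∀ (γ : ℝ≥0) (C₂ : ℝ), 0 < γ → 0 < C₂ →
    ∃ cstar : ℝ, 0 < cstar ∧ ∀ c₀ ν : ℝ, cstar ≤ c₀ → 1 < ν →
    ∃ C₁ : ℝ, 0 < C₁ ∧ ∀ c C : ℝ, 0 < c → c ≤ 1 / 2 → 0 < C →
    ∃ M : ℝ, 0 < M ∧
    ∀ (n p K : ℕ) (_hn : 1 ≤ n)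
      -- the population law
      (Ω₀ : Type*) [MeasurableSpace Ω₀] (P : Measure Ω₀) [IsProbabilityMeasure P]
      (Z₀ : Ω₀ → EuclideanSpace ℝ (Fin K)) (W₀ : Ω₀ → EuclideanSpace ℝ (Fin p))
      (Y₀ : Ω₀ → Fin 2)
      (A : Matrix (Fin p) (Fin K) ℝ) (α : Fin 2 → EuclideanSpace ℝ (Fin K))
      (SZ : Matrix (Fin K) (Fin K) ℝ)
      (_hmodel : LatentMixtureModel P A α SZ γ c Z₀ W₀ Y₀)
      -- the sample
      (Ω : Type*) [MeasurableSpace Ω] (μ : Measure Ω) [IsProbabilityMeasure μ]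
      (Z : Fin n → Ω → EuclideanSpace ℝ (Fin K)) (W : Fin n → Ω → EuclideanSpace ℝ (Fin p))
      (Y : Fin n → Ω → Fin 2)
      (_hindep : iIndepFun (fun i ω => (Z i ω, W i ω, Y i ω)) μ)
      (_hident : ∀ i, IdentDistrib (fun ω => (Z i ω, W i ω, Y i ω))
        (fun ω => (Z₀ ω, W₀ ω, Y₀ ω)) μ P)
      -- the dimension, signal and noise conditions
      (_hK : K ≤ maxRank c₀ ν n p)
      (_hp : Real.log p ≤ C * n)
      (_hξ : C₁ ≤ signalToNoise n A SZ (covMat P W₀))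
      (_hre : C₂ * ((min n p : ℕ) : ℝ) ≤ effectiveRank (covMat P W₀))
      -- the selected rank
      (Khat : Ω → ℕ)
      (_hKhat : ∀ ω, IsRankEstimate c₀ ν
        (dataMatrix A (fun i => Z i ω) (fun i => W i ω)) (Khat ω)),
      1 - M / n ≤ μ.real {ω | Khat ω = K} := by
  intro γ C₂ hγ hC₂
  set L : ℝ := 48 * (γ : ℝ) ^ 2 with hL
  have hγ' : (0 : ℝ) < γ := by exact_mod_cast hγ
  have hLpos : 0 < L := by positivity
  -- The `500` turns the rank cap into `1000 K ≤ n ∧ p`; the remaining terms meet the noise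
  -- condition strictly.
  refine ⟨500 + (8 * L * (1 / C₂ + 1) + 1), by positivity, fun c₀ ν hc₀ hν => ?_⟩
  have hextra : 0 < 8 * L * (1 / C₂ + 1) := by positivity
  have hc500 : 500 ≤ c₀ := by linarith
  have hc₀L : 8 * L * (1 / C₂ + 1) < c₀ := by linarith
  have hν0 : 0 < ν := by linarith
  -- `τ = 1/2000` is half of the pair-energy constant `1/1000`.
  refine ⟨4 * (L + 2 * (1 + ν) * c₀) / (1 / 2000), by positivity, fun c C _ _ _ => ?_⟩
  set κ : ℝ := (γ : ℝ) ^ 2 with hκ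
  have hκ0 : 0 < κ := by positivity
  -- The `κ` terms bound the energy event. The `42 = 1 + 1 + 40` comes from `e^{-n}` twice and
  -- `e^{-n/40}` once, via `e^{-x} ≤ 1/x`.
  refine ⟨256 * κ ^ 2 + 32 * κ + 42, by positivity, ?_⟩
  intro n p K hn Ω₀ _ P _ Z₀ W₀ Y₀ A α SZ hmodel Ω _ μ _ Z W Y hindep hident hK _ hξ hre Khat hKhat
  have hK1 : 1 ≤ K := by
    by_contra h
    -- In `ℝ⁰` the two class means would coincide.
    obtain rfl : K = 0 := by omega
    exact hmodel.means_ne (Subsingleton.elim _ _)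
  have hKmin := (le_maxRank_iff (by linarith) hν0).1 hK
  have hK1' : (1 : ℝ) ≤ K := by exact_mod_cast hK1
  have hKn : (1000 : ℝ) * K ≤ ((min n p : ℕ) : ℝ) := by
    have h1 : ν / (2 * c₀ * (1 + ν)) ≤ 1 / 1000 := by
      rw [div_le_div_iff₀ (by positivity) (by norm_num)]
      nlinarith
    have h2 : (0 : ℝ) ≤ ((min n p : ℕ) : ℝ) := by positivity
    nlinarith
  have hKn' : 1000 * K ≤ min n p := by exact_mod_cast hKn
  have hKn1 : 1000 * K ≤ n := hKn'.trans (min_le_left _ _)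
  have hKp : K ≤ p := by have := hKn'.trans (min_le_right _ _); omega
  have hp : 0 < p := by omega
  have hmin0 : (0 : ℝ) < ((min n p : ℕ) : ℝ) := by linarith
  have hn0 : (0 : ℝ) < n := by exact_mod_cast hn
  -- spectrum of the noise covariance
  set SW := covMat P W₀ with hSW
  have hpsd : SW.PosSemidef := covMat_posSemidef_of_isSubGaussianNoise hmodel.noise
  have hH := hpsd.isHermitian
  set l := eigDesc SW 1 with hl
  set t := SW.trace with ht
  have hev : ∀ j, 0 ≤ hH.eigenvalues j := hpsd.eigenvalues_nonneg
  have hevl : ∀ j, hH.eigenvalues j ≤ l := eigenvalues_le_eigDesc_one hH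
  have htr : t = ∑ j, hH.eigenvalues j := trace_eq_sum_eigenvalues_real hH
  have hl0 : 0 < l := by
    -- If `λ_1 = 0`, division by zero makes the effective rank `0`, against its positive lower
    -- bound.
    refine lt_of_le_of_ne ((hev ⟨0, hp⟩).trans (hevl _)) fun h => ?_
    rw [effectiveRank, ← hl, ← h, div_zero] at hre
    have : 0 < C₂ * ((min n p : ℕ) : ℝ) := by positivity
    linarith
  have hre' : C₂ * ((min n p : ℕ) : ℝ) * l ≤ t := (le_div_iff₀ hl0).1 hre
  have ht0 : 0 < t := lt_of_lt_of_le (by positivity) hre'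
  have htl : t ≤ p * l := by
    rw [htr]
    calc ∑ j, hH.eigenvalues j ≤ ∑ _j : Fin p, l := Finset.sum_le_sum fun j _ => hevl j
      _ = p * l := by simp
  have hδ : 0 < l + t / n := by positivity
  have hsnr : 4 * (L + 2 * (1 + ν) * c₀) / (1 / 2000) * (l + t / n) ≤
      eigDesc (A * SZ * A.transpose) K := (le_div_iff₀ hδ).1 hξ
  -- measurable versions of the sample
  let ζ : Fin n → Ω → EuclideanSpace ℝ (Fin K) × EuclideanSpace ℝ (Fin p) × Fin 2 :=
    fun i => (hident i).aemeasurable_fst.mk _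
  have hζm : ∀ i, Measurable (ζ i) := fun i => (hident i).aemeasurable_fst.measurable_mk
  have hζae : ∀ i, (fun ω => (Z i ω, W i ω, Y i ω)) =ᵐ[μ] ζ i := fun i =>
    (hident i).aemeasurable_fst.ae_eq_mk
  have hζind : iIndepFun ζ μ := (iIndepFun_congr hζae).1 hindep
  have hζid : ∀ i, IdentDistrib (ζ i) (fun ω => (Z₀ ω, W₀ ω, Y₀ ω)) μ P := fun i =>
    (IdentDistrib.of_ae_eq (hident i).aemeasurable_fst (hζae i)).symm.trans (hident i)
  have hWm : ∀ i, Measurable fun ω => (ζ i ω).2.1 := fun i =>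
    (measurable_fst.comp measurable_snd).comp (hζm i)
  have hYm : ∀ i, Measurable fun ω => (ζ i ω).2.2 := fun i =>
    (measurable_snd.comp measurable_snd).comp (hζm i)
  -- the noise
  have hWid : ∀ i, IdentDistrib (fun ω => (ζ i ω).2.1) W₀ μ P := fun i =>
    (hζid i).comp (measurable_fst.comp measurable_snd)
  have hWind : iIndepFun (fun i ω => (ζ i ω).2.1) μ :=
    hζind.comp (fun _ z => z.2.1) fun _ => by fun_prop
  let Q : EuclideanSpace ℝ (Fin p) → ℝ≥0 := fun u =>
    γ ^ 2 * (inner ℝ u (Matrix.toEuclideanLin SW u)).toNNReal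
  have hQ : ∀ i u, HasSubgaussianMGF (fun ω => inner ℝ u (ζ i ω).2.1) (Q u) μ := fun i u =>
    (hmodel.noise.hasSubgaussianMGF_inner u).congr_identDistrib
      ((hWid i).comp (u := fun x => inner ℝ u x) (by fun_prop)).symm
  have hQl : ∀ u, (Q u : ℝ) =
      ∑ j, κ * hH.eigenvalues j * inner ℝ (hH.eigenvectorBasis j) u ^ 2 := fun u => by
    have h1 := inner_toEuclideanLin_eq_sum hH u
    have h2 : 0 ≤ inner ℝ u (Matrix.toEuclideanLin SW u) := by
      rw [h1]; exact Finset.sum_nonneg fun j _ => mul_nonneg (hev j) (sq_nonneg _)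
    simp only [Q]
    rw [NNReal.coe_mul, Real.coe_toNNReal _ h2, h1, Finset.mul_sum]
    simp [mul_assoc, hκ]
  have hκev : ∀ j, 0 ≤ κ * hH.eigenvalues j := fun j => mul_nonneg hκ0.le (hev j)
  have hκsum : ∑ j, κ * hH.eigenvalues j = κ * t := by rw [← Finset.mul_sum, htr]
  have hbad1 := measure_exists_sum_sq_inner_gt_le hWm hWind hQ hH.eigenvectorBasis hκev hQl
    (Λ := κ * l) (by positivity) fun j => mul_le_mul_of_nonneg_left (hevl j) hκ0.le
  have hbad2 := measure_norm_sq_sum_bounds_le hn hWm hWind hQ hH.eigenvectorBasis hκev hQl ht0 hκ0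
    hκsum fun i => by
      have h1 := ((hWid i).comp (u := fun x => ‖x‖ ^ 2) (by fun_prop)).integral_eq
      exact h1.trans <| integral_norm_sq_eq_trace_covMat hmodel.noise hmodel.mean_W
  -- the Gaussian design
  have hν2 : IsProbabilityMeasure (P.map Y₀) :=
    Measure.isProbabilityMeasure_map hmodel.measurable_Y.aemeasurable
  obtain ⟨m, f, g, hfg, hnm⟩ := exists_disjoint_pairs (show 2 ≤ n by omega)
  let w : EuclideanSpace ℝ (Fin K) × EuclideanSpace ℝ (Fin p) × Fin 2 →
      EuclideanSpace ℝ (Fin K) := fun z => whiten SZ (α z.2.2) z.1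
  have hwm : Measurable w := measurable_whiten_label SZ α measurable_fst
    (measurable_snd.comp measurable_snd)
  have hbad3 := measure_exists_pairEnergy_lt_le hfg hnm
    (by rw [finrank_euclideanSpace_fin]; exact hKn1) (fun i => hwm.comp (hζm i)) hYm
    (hζind.comp (fun _ z => (w z, z.2.2)) fun _ => by fun_prop) (ν := P.map Y₀) fun i => by
      have h1 := ((hζid i).comp (u := fun z => (w z, z.2.2)) (by fun_prop)).map_eq
      exact h1.trans (map_whiten_prodMk_label hmodel.posDef_SZ hmodel.measurable_Z
        hmodel.measurable_Y hmodel.gaussian)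
  have hnull : μ {ω | ¬∀ i, (Z i ω, W i ω, Y i ω) = ζ i ω} = 0 :=
    (ae_all_iff.2 hζae : ∀ᵐ ω ∂μ, ∀ i, (Z i ω, W i ω, Y i ω) = ζ i ω)
  -- on the good event the estimate is exact
  set B₁ := {ω | ∃ x, 48 * (n * (κ * l) + ∑ j, κ * hH.eigenvalues j) * ‖x‖ ^ 2 <
    ∑ i, inner ℝ (ζ i ω).2.1 x ^ 2} with hB₁
  set B₂ := {ω | ¬(n * t / 2 ≤ ∑ i, ‖(ζ i ω).2.1‖ ^ 2 ∧
    ∑ i, ‖(ζ i ω).2.1‖ ^ 2 ≤ 3 / 2 * (n * t) ∧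
    (n : ℝ)⁻¹ * ‖∑ i, (ζ i ω).2.1‖ ^ 2 ≤ n * t / 4)} with hB₂
  set B₃ := {ω | ∃ v, pairEnergy f g (fun i => ((w ∘ ζ i) ω, (ζ i ω).2.2)) v <
    n / 1000 * ‖v‖ ^ 2} with hB₃
  have hsub : {ω | Khat ω = K}ᶜ ⊆
      {ω | ¬∀ i, (Z i ω, W i ω, Y i ω) = ζ i ω} ∪ (B₁ ∪ (B₂ ∪ B₃)) := by
    intro ω hω
    by_contra hcon
    rw [Set.mem_union, not_or, Set.mem_union, not_or, Set.mem_union, not_or] at hcon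
    obtain ⟨hg0, hg1, hg2, hg3⟩ := hcon
    rw [Set.mem_ofPred_eq, not_not] at hg0
    rw [hB₁, Set.mem_ofPred_eq] at hg1
    rw [hB₂, Set.mem_ofPred_eq, not_not] at hg2
    rw [hB₃, Set.mem_ofPred_eq] at hg3
    simp only [w, Function.comp_apply, ← hg0] at hg1 hg2 hg3
    push Not at hg1 hg3
    refine hω (IsRankEstimate.eq_of_bounds (τ := 1 / 2000) hLpos.le hC₂ (by linarith) hc₀L hν0
      (by norm_num) hn hp hK1 hKp hK hmodel.posDef_SZ.isHermitian hl0 ht0 htl hre' hsnr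
      (fun x => (hg1 x).trans_eq ?_) hg2.1 hg2.2.1 hg2.2.2 (fun u => ?_) (hKhat ω))
    · rw [hκsum, hL]; ring
    · refine le_trans (le_of_eq ?_) (mul_inner_le_sum_sq_inner_centered hfg hmodel.posDef_SZ hg3 u)
      ring
  have hb0 := (measure_mono hsub).trans ((measure_union_le _ _).trans
    (add_le_add hnull.le ((measure_union_le _ _).trans
      (add_le_add hbad1 ((measure_union_le _ _).trans (add_le_add hbad2 hbad3))))))
  have hM0 : 0 ≤ (256 * κ ^ 2 + 32 * κ) / n := by positivity
  rw [zero_add, ← ENNReal.ofReal_add hM0 (by positivity),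
    ← ENNReal.ofReal_add (by positivity) (by positivity)] at hb0
  have hb1 := ENNReal.toReal_le_of_le_ofReal (by positivity) hb0
  -- Only subadditivity of the outer measure is used, so `Khat` may be any selection of minimisers,
  -- measurable or not.
  have huniv : (1 : ℝ) ≤ μ.real {ω | Khat ω = K} + μ.real {ω | Khat ω = K}ᶜ := by
    have h := measureReal_union_le (μ := μ) {ω | Khat ω = K} {ω | Khat ω = K}ᶜ
    rwa [Set.union_compl_self, probReal_univ] at h
  have he1 := exp_neg_le_inv hn0
  have he2 := exp_neg_le_inv (x := (n : ℝ) / 40) (by positivity)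
  have he3 : ((n : ℝ) / 40)⁻¹ = 40 * (n : ℝ)⁻¹ := by rw [inv_div]; ring
  have he4 : (256 * κ ^ 2 + 32 * κ + 42) / n =
      (256 * κ ^ 2 + 32 * κ) / n + 42 * (n : ℝ)⁻¹ := by ring
  rw [measureReal_def _ {ω | Khat ω = K}ᶜ] at huniv
  rw [he4]
  linarith
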